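/- Setting. Index the sites of the hexagonal lattice $\Gamma=\Gamma_A\cup\Gamma_B$ by $\mathbb Z^2\times\{A,B\}$, writing $|j,k\rangle\otimes f_1$ for the $\Gamma_A$ site and $|j,k\rangle\otimes f_2$ for the $\Gamma_B$ site with coordinates $(j,k)$. Let $\mathcal H=\ell^2(\Gamma)\otimes\mathbb C^3$, let $e_1,e_2,e_3$ be the standard basis of $\mathbb C^3$, and write $x^{(i)}=|x\rangle\otimes e_i$. The shift is $S=\sum_{i=1}^3 S_i\otimes|e_i\rangle\langle e_i|$, where $$\begin{aligned} S_1|j,k\rangle f_1&=|j,k-1\rangle f_2, & S_1|j,k\rangle f_2&=|j-1,k+1\rangle f_1,\\ S_2|j,k\rangle f_1&=|j+1,k-1\rangle f_2, & S_2|j,k\rangle f_2&=|j,k\rangle f_1,\\ S_3|j,k\rangle f_1&=|j,k\rangle f_2, & S_3|j,k\rangle f_2&=|j,k+1\rangle f_1.\end{aligned}$$ Let $(\omega_x)_{x\in\Gamma}$ be i.i.d. random variables, uniform on $[0,2\pi)$, let $\mathbb E$ be the expectation with respect to them, and put $D_\omega(|x\rangle\otimes\tau)=e^{i\omega_x}|x\rangle\otimes\tau$.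 Let $C_0=\begin{pmatrix}0&1&0\\0&0&1\\1&0&0\end{pmatrix}$, and for a $3\times 3$ matrix $M$ let $\|M\|_\infty=\max_{k,l}|M_{kl}|$. For $j,k\in\mathbb Z$ let $$\mathcal H^{j,k}=\mathrm{span}\{|j,k\rangle f_1 e_1,\ |j,k\rangle f_1 e_2,\ |j,k\rangle f_1 e_3,\ |j,k\rangle f_2 e_3,\ |j,k-1\rangle f_2 e_1,\ |j+1,k-1\rangle f_2 e_2\},$$ and write $x^{(i)}\sim y^{(l)}$ if both vectors lie in a common $\mathcal H^{j,k}$. For $L=(L_1,L_2)\in\mathbb N^2$ let $|L|=\sqrt{L_1^2+L_2^2}$, and for $v\in\mathbb Z^2$ (a translation in $\Gamma_A$) let $\mathcal H_{L}+v=\bigoplus\mathcal H^{(j,k)+v}$, the sum running over $-L_1\le j\le L_1-1$, $-L_2\le k\le L_2-1$, $j+k>-L_1-L_2$. Let $\Gamma_{C_0}^{(L)}$ be the set of $\Gamma_B$ sites $|j,k\rangle\otimes f_2$ with $$\begin{aligned}&(-L_1\le j\le L_1-1,\ k=L_2-1)\ \text{ or }\ (-L_1+1\le j\le L_1,\ k=-L_2-1)\\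 \text{ or }\ &(j=L_1,\ -L_2\le k\le L_2-2)\ \text{ or }\ (j=-L_1,\ -L_2\le k\le L_2-2).\end{aligned}$$ For $C\in U(3)$ let $\mathcal C^{\Lambda_L+v}$ act as $|x\rangle\otimes\tau\mapsto|x\rangle\otimes C_0\tau$ if $x\in\Gamma_{C_0}^{(L)}+v$ and as $|x\rangle\otimes\tau\mapsto|x\rangle\otimes C\tau$ otherwise. The operator $D_\omega S\,\mathcal C^{\Lambda_L+v}$ leaves $\mathcal H_L+v$ invariant; let $U_\omega^{\Lambda_L+v}(C)$ be its restriction to $\mathcal H_L+v$, and $R_\omega^{\Lambda_L+v}(C,z)=(U_\omega^{\Lambda_L+v}(C)-z)^{-1}$. Proposition. For any $s\in(0,1)$, $p>\frac1{1-s}$ and $a\ge0$ there exists $c>0$ such that $$\mathbb E\Big(\big|\langle x^{(i)}\,|\,R_\omega^{\Lambda_L+v}(C,z)\,y^{(j)}\rangle\big|^s\Big)\le\frac{c}{|L|^a}$$ for all $L\in\mathbb N^2$ with $\min(L_1,L_2)\ge3$, all $z\in\mathbb C$ with $|z|\ne1$ (every such $z$ is in the resolvent set of $U_\omega^{\Lambda_L+v}(C)$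 for every $\omega$), all $C\in U(3)$ with $\|C-C_0\|_\infty\le|L|^{-(2ap+4+a/s)}$, all $v\in\mathbb Z^2$, and all $x^{(i)},y^{(j)}\in\mathcal H_L+v$ with $x^{(i)}\nsim y^{(j)}$. -/

import Mathlib

open MeasureTheory ProbabilityTheory

namespace HexWalk

/-! ### The hexagonal lattice -/

/-- The two triangular sublattices of the hexagonal lattice. -/
inductive Sublattice : Type
  | A : Sublattice
  | B : Sublattice

/-- Sites of the hexagonal lattice: `((j, k), A)` is the site with coordinates `j, k` with
respect to the two vectors spanning the sublattice `A`, and `((j, k), B)` is its translate in the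
sublattice `B`. -/
abbrev Site : Type := (ℤ × ℤ) × Sublattice

/-- Displacement of the cell coordinates when the shift number `i` leaves an `A` site. -/
def stepA : Fin 3 → ℤ × ℤ := ![(0, -1), (1, -1), (0, 0)]

/-- Displacement of the cell coordinates when the shift number `i` leaves a `B` site. -/
def stepB : Fin 3 → ℤ × ℤ := ![(-1, 1), (0, 0), (0, 1)]

/-- The permutation of the sites that underlies the shift number `i`. -/
def hop (i : Fin 3) : Equiv.Perm Site where
  toFun
    | (n, .A) => (n + stepA i, .B)
    | (n, .B) => (n + stepB i, .A)
  invFun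
    | (n, .A) => (n - stepB i, .B)
    | (n, .B) => (n - stepA i, .A)
  left_inv := by rintro ⟨n, _ | _⟩ <;> simp
  right_inv := by rintro ⟨n, _ | _⟩ <;> simp

/-! ### The Hilbert space and the operators -/

/-- The coin space `ℂ³`. -/
abbrev Coin : Type := EuclideanSpace ℂ (Fin 3)

/-- The Hilbert space `ℓ²(Γ) ⊗ ℂ³`, realised as `ℓ²(Γ; ℂ³)`. -/
abbrev WalkSpace : Type := lp (fun _ : Site => Coin) 2

open scoped Classical in
/-- The basis vector `x⁽ⁱ⁾ = |x⟩ ⊗ eᵢ`. -/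
noncomputable def ket (x : Site) (i : Fin 3) : WalkSpace :=
  lp.single 2 x (EuclideanSpace.single i 1)

/-- The operator `|x⟩ ⊗ τ ↦ |σ x⟩ ⊗ τ`. -/
noncomputable def translate (σ : Equiv.Perm Site) : WalkSpace →L[ℂ] WalkSpace :=
  LinearMap.mkContinuous
    { toFun := fun ψ => ⟨fun x => ψ (σ.symm x), memℓp_gen
        (((lp.memℓp ψ).summable (by norm_num)).comp_injective σ.symm.injective)⟩
      map_add' := fun _ _ => rfl
      map_smul' := fun _ _ => rfl }
    1
    (fun ψ => by
      have h2 : 0 < (2 : ENNReal).toReal := by norm_num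
      have h := lp.norm_eq_tsum_rpow h2 ψ
      rw [lp.norm_eq_tsum_rpow h2, one_mul, h]
      exact (congrArg (· ^ (1 / (2 : ENNReal).toReal))
        (σ.symm.tsum_eq (fun x => ‖ψ x‖ ^ (2 : ENNReal).toReal))).le)

/-- The rank one projection `|eᵢ⟩⟨eᵢ|` on the coin space. -/
noncomputable def coinProj (i : Fin 3) : Coin →L[ℂ] Coin :=
  InnerProductSpace.rankOne ℂ (EuclideanSpace.single i (1 : ℂ)) (EuclideanSpace.single i (1 : ℂ))

/-- The shift `S = S₁ ⊗ |e₁⟩⟨e₁| + S₂ ⊗ |e₂⟩⟨e₂| + S₃ ⊗ |e₃⟩⟨e₃|`. -/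
noncomputable def shift : WalkSpace →L[ℂ] WalkSpace :=
  ∑ i : Fin 3, translate (hop i) ∘L
    lp.mapCLM 2 (fun _ : Site => coinProj i) (norm_nonneg (coinProj i)) (fun _ => le_rfl)

theorem norm_toEuclideanCLM_le (M : Matrix.unitaryGroup (Fin 3) ℂ) :
    ‖Matrix.toEuclideanCLM (n := Fin 3) (𝕜 := ℂ) (M : Matrix (Fin 3) (Fin 3) ℂ)‖ ≤ 1 :=
  (CStarRing.norm_of_mem_unitary
    (Unitary.map_mem (Matrix.toEuclideanCLM (n := Fin 3) (𝕜 := ℂ)) M.2)).le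

/-- The coin operator `|x⟩ ⊗ τ ↦ |x⟩ ⊗ C_x τ` of a family of unitary coin matrices. -/
noncomputable def coinOp (C : Site → Matrix.unitaryGroup (Fin 3) ℂ) : WalkSpace →L[ℂ] WalkSpace :=
  lp.mapCLM 2
    (fun x => Matrix.toEuclideanCLM (n := Fin 3) (𝕜 := ℂ) (C x : Matrix (Fin 3) (Fin 3) ℂ))
    zero_le_one (fun x => norm_toEuclideanCLM_le (C x))

theorem norm_phase_le (t : ℝ) :
    ‖Complex.exp (Complex.I * t) • ContinuousLinearMap.id ℂ Coin‖ ≤ 1 := by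
  rw [norm_smul, mul_comm Complex.I, Complex.norm_exp_ofReal_mul_I, one_mul]
  exact ContinuousLinearMap.norm_id_le

/-- The random phase operator `|x⟩ ⊗ τ ↦ e^{i ω_x} |x⟩ ⊗ τ`. -/
noncomputable def phaseOp (ω : Site → ℝ) : WalkSpace →L[ℂ] WalkSpace :=
  lp.mapCLM 2 (fun x => Complex.exp (Complex.I * ω x) • ContinuousLinearMap.id ℂ Coin)
    zero_le_one (fun x => norm_phase_le (ω x))

/-- The walk `D_ω S 𝒞` for a family of coin matrices and a realisation `ω` of the phases. -/
noncomputable def walk (C : Site → Matrix.unitaryGroup (Fin 3) ℂ) (ω : Site → ℝ) :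
    WalkSpace →L[ℂ] WalkSpace :=
  phaseOp ω ∘L shift ∘L coinOp C

/-- The coin matrix `C₀` of the fully localised walk. -/
noncomputable def coinZero : Matrix.unitaryGroup (Fin 3) ℂ :=
  ⟨!![0, 1, 0; 0, 0, 1; 1, 0, 0], by
    rw [Matrix.mem_unitaryGroup_iff]
    ext i j
    fin_cases i <;> fin_cases j <;>
      simp [Matrix.mul_apply, Fin.sum_univ_three, Matrix.star_apply]⟩

/-- The maximum of the moduli of the entries of a matrix. -/
noncomputable def entrySup (M : Matrix (Fin 3) (Fin 3) ℂ) : ℝ :=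
  Finset.univ.sup' Finset.univ_nonempty (fun q : Fin 3 × Fin 3 => ‖M q.1 q.2‖)

/-! ### Cells and boxes -/

/-- The six pairs (site, coin state) that span the invariant subspace with label `(j, k)`. -/
def cellLabels (n : ℤ × ℤ) : Set (Site × Fin 3) :=
  {((n, .A), 0), ((n, .A), 1), ((n, .A), 2),
    ((n, .B), 2), (((n.1, n.2 - 1), .B), 0), (((n.1 + 1, n.2 - 1), .B), 1)}

/-- The subspace `ℋ^{j,k}`, invariant under the walk with coin `C₀`. -/
noncomputable def cell (n : ℤ × ℤ) : Submodule ℂ WalkSpace :=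
  Submodule.span ℂ ((fun b : Site × Fin 3 => ket b.1 b.2) '' cellLabels n)

/-- The relation `x⁽ⁱ⁾ ∼ y⁽ˡ⁾`: both vectors lie in a common `ℋ^{j,k}`. -/
def Equivalent (x : Site) (i : Fin 3) (y : Site) (l : Fin 3) : Prop :=
  ∃ n : ℤ × ℤ, ket x i ∈ cell n ∧ ket y l ∈ cell n

/-- Labels `(j, k)` of the cells forming the box of size `L`, centred at the origin. -/
def boxCells (L : ℕ × ℕ) : Set (ℤ × ℤ) :=
  {n | -(L.1 : ℤ) ≤ n.1 ∧ n.1 ≤ (L.1 : ℤ) - 1 ∧ -(L.2 : ℤ) ≤ n.2 ∧ n.2 ≤ (L.2 : ℤ) - 1 ∧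
    -(L.1 : ℤ) - L.2 < n.1 + n.2}

/-- The subspace `ℋ_L` belonging to the box, translated by `v`. -/
noncomputable def boxSpace (L : ℕ × ℕ) (v : ℤ × ℤ) : Submodule ℂ WalkSpace :=
  ⨆ n ∈ boxCells L, cell (n + v)

/-- Coordinates of the `B` sites around the box of size `L` (centred at the origin) at which the
coin matrix is replaced by `C₀`. -/
def rim (L : ℕ × ℕ) : Set (ℤ × ℤ) :=
  {n | (-(L.1 : ℤ) ≤ n.1 ∧ n.1 ≤ (L.1 : ℤ) - 1 ∧ n.2 = (L.2 : ℤ) - 1) ∨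
    (-(L.1 : ℤ) + 1 ≤ n.1 ∧ n.1 ≤ (L.1 : ℤ) ∧ n.2 = -(L.2 : ℤ) - 1) ∨
    (n.1 = (L.1 : ℤ) ∧ -(L.2 : ℤ) ≤ n.2 ∧ n.2 ≤ (L.2 : ℤ) - 2) ∨
    (n.1 = -(L.1 : ℤ) ∧ -(L.2 : ℤ) ≤ n.2 ∧ n.2 ≤ (L.2 : ℤ) - 2)}

open scoped Classical in
/-- The coin matrices of the boxed walk: `C₀` on the rim of the translated box and `C` elsewhere. -/
noncomputable def boxCoin (L : ℕ × ℕ) (v : ℤ × ℤ) (C : Matrix.unitaryGroup (Fin 3) ℂ) :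
    Site → Matrix.unitaryGroup (Fin 3) ℂ
  | (_, .A) => C
  | (n, .B) => if n - v ∈ rim L then coinZero else C

theorem translate_apply (σ : Equiv.Perm Site) (ψ : WalkSpace) (x : Site) :
    translate σ ψ x = ψ (σ.symm x) := rfl

theorem coinProj_apply (i : Fin 3) (τ : Coin) :
    coinProj i τ = τ i • EuclideanSpace.single i (1 : ℂ) := by
  simp [coinProj, EuclideanSpace.inner_single_left]

theorem ket_apply (x : Site) (i : Fin 3) (y : Site) (k : Fin 3) [Decidable (y = x)] :
    ket x i y k = if y = x then (if k = i then 1 else 0) else 0 := by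
  classical
  by_cases h : y = x
  · subst h
    simp [ket]
  · simp [ket, h]

/-- The action of the walk on basis vectors. -/
theorem walk_ket (C : Site → Matrix.unitaryGroup (Fin 3) ℂ) (ω : Site → ℝ) (x : Site)
    (i : Fin 3) :
    walk C ω (ket x i) =
      ∑ l : Fin 3, (Complex.exp (Complex.I * ω (hop l x)) *
        (C x : Matrix (Fin 3) (Fin 3) ℂ) l i) • ket (hop l x) l := by
  classical
  have hcoin : ∀ (y : Site) (l : Fin 3), (coinOp C (ket x i)) y l =
      if y = x then (C x : Matrix (Fin 3) (Fin 3) ℂ) l i else 0 := by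
    intro y l
    have h1 : (coinOp C (ket x i)) y l =
        ∑ k, (C y : Matrix (Fin 3) (Fin 3) ℂ) l k * ket x i y k := rfl
    rw [h1]
    by_cases h : y = x
    · subst h
      simp [ket_apply]
    · simp [ket_apply, h]
  ext y k
  have hL : (walk C ω (ket x i)) y k = Complex.exp (Complex.I * ω y) *
      (shift (coinOp C (ket x i))) y k := rfl
  have hS : ∀ ψ : WalkSpace, (shift ψ) y k = ψ ((hop k).symm y) k := by
    intro ψ
    have : shift ψ = ∑ l : Fin 3, translate (hop l)
        (lp.mapCLM 2 (fun _ : Site => coinProj l) (norm_nonneg (coinProj l))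
          (fun _ => le_rfl) ψ) := by
      simp [shift]
    rw [this, lp.coeFn_sum, Finset.sum_apply]
    simp [translate_apply, coinProj_apply, Pi.single_apply]
  rw [hL, hS, hcoin]
  simp only [lp.coeFn_sum, Finset.sum_apply, lp.coeFn_smul, Pi.smul_apply, PiLp.smul_apply,
    WithLp.ofLp_sum, ket_apply, smul_eq_mul, Equiv.symm_apply_eq]
  simp only [mul_ite, mul_one, mul_zero]
  have : ∀ l : Fin 3, (if y = hop l x then (if k = l then
      Complex.exp (Complex.I * ω (hop l x)) * (C x : Matrix (Fin 3) (Fin 3) ℂ) l i else 0) else 0)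
      = if k = l then (if y = hop k x then
      Complex.exp (Complex.I * ω y) * (C x : Matrix (Fin 3) (Fin 3) ℂ) k i else 0) else 0 := by
    intro l
    by_cases h : k = l
    · subst h
      by_cases h' : y = hop k x
      · simp [h']
      · simp [h']
    · simp [h]
  rw [Finset.sum_congr rfl (fun l _ => this l)]
  simp

theorem ket_mem_boxSpace {L : ℕ × ℕ} {v n : ℤ × ℤ} (hn : n - v ∈ boxCells L) {x : Site}
    {i : Fin 3} (h : (x, i) ∈ cellLabels n) : ket x i ∈ boxSpace L v := by
  have h1 : cell (n - v + v) ≤ boxSpace L v :=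
    le_iSup₂_of_le (f := fun m (_ : m ∈ boxCells L) => cell (m + v)) (n - v) hn le_rfl
  rw [sub_add_cancel] at h1
  exact h1 (Submodule.subset_span ⟨(x, i), h, rfl⟩)

/-- The boxed walk leaves the subspace of the box invariant. -/
theorem boxSpace_invariant (L : ℕ × ℕ) (v : ℤ × ℤ) (C : Matrix.unitaryGroup (Fin 3) ℂ)
    (ω : Site → ℝ) : ∀ ψ ∈ boxSpace L v, walk (boxCoin L v C) ω ψ ∈ boxSpace L v := by
  classical
  suffices h : boxSpace L v ≤ (boxSpace L v).comap (walk (boxCoin L v C) ω).toLinearMap from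
    fun ψ hψ => h hψ
  refine iSup₂_le fun n hn => Submodule.span_le.2 ?_
  rintro _ ⟨⟨x, i⟩, hb, rfl⟩
  change walk (boxCoin L v C) ω (ket x i) ∈ boxSpace L v
  rw [walk_ket]
  have hA : ∀ l : Fin 3, (hop l (n + v, .A), l) ∈ cellLabels (n + v) := by
    intro l
    fin_cases l <;> simp [hop, stepA, cellLabels, Prod.ext_iff, sub_eq_add_neg]
  have hB : ∀ (m : ℤ × ℤ) (l : Fin 3), (hop l (m, .B), l) ∈ cellLabels (m + stepB l) := by
    intro m l
    fin_cases l <;> simp [hop, cellLabels]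
  have hrim : ∀ m : ℤ × ℤ, m - v ∉ rim L → (∃ l, m + stepB l = n + v) →
      ∀ l, m + stepB l - v ∈ boxCells L := by
    rintro ⟨m₁, m₂⟩ hm ⟨l', hl'⟩ l
    obtain ⟨p, q⟩ := n
    obtain ⟨v₁, v₂⟩ := v
    fin_cases l' <;> fin_cases l <;>
      simp [stepB, boxCells, rim, Prod.ext_iff] at hl' hm hn ⊢ <;> omega
  have hnv : n + v - v ∈ boxCells L := by rwa [add_sub_cancel_right]
  have hC0 : ∀ (m : ℤ × ℤ), ((m, Sublattice.B), i) ∈ cellLabels (n + v) →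
      ∃ l, m + stepB l = n + v ∧
        ∀ j, j ≠ l → (coinZero : Matrix (Fin 3) (Fin 3) ℂ) j i = 0 := by
    rintro ⟨m₁, m₂⟩ hm
    obtain ⟨p, q⟩ := n
    obtain ⟨v₁, v₂⟩ := v
    fin_cases i
    · refine ⟨2, ?_, ?_⟩
      · simp [cellLabels, stepB, Prod.ext_iff] at hm ⊢
        omega
      · intro j hj
        fin_cases j <;> simp_all [coinZero]
    · refine ⟨0, ?_, ?_⟩
      · simp [cellLabels, stepB, Prod.ext_iff] at hm ⊢
        omega
      · intro j hj
        fin_cases j <;> simp_all [coinZero]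
    · refine ⟨1, ?_, ?_⟩
      · simp [cellLabels, stepB, Prod.ext_iff] at hm ⊢
        omega
      · intro j hj
        fin_cases j <;> simp_all [coinZero]
  refine Submodule.sum_mem _ fun l _ => ?_
  obtain ⟨m, _ | _⟩ := x
  · have hm : m = n + v := by
      simp [cellLabels] at hb
      tauto
    subst hm
    exact Submodule.smul_mem _ _ (ket_mem_boxSpace hnv (hA l))
  · obtain ⟨l', hl', hz⟩ := hC0 m hb
    by_cases hm : m - v ∈ rim L
    · by_cases hl : l = l'
      · subst hl
        exact Submodule.smul_mem _ _ (ket_mem_boxSpace (hl' ▸ hnv) (hB m l))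
      · have : (boxCoin L v C (m, .B) : Matrix (Fin 3) (Fin 3) ℂ) l i = 0 := by
          simp [boxCoin, hm, hz l hl]
        rw [this, mul_zero, zero_smul]
        exact Submodule.zero_mem _
    · exact Submodule.smul_mem _ _ (ket_mem_boxSpace (hrim m hm ⟨l', hl'⟩ l) (hB m l))

/-- The walk restricted to the box: the restriction to `boxSpace L v` of the walk whose coin
matrices are replaced by `C₀` on the rim of the box. -/
noncomputable def boxWalk (L : ℕ × ℕ) (v : ℤ × ℤ) (C : Matrix.unitaryGroup (Fin 3) ℂ)
    (ω : Site → ℝ) : boxSpace L v →L[ℂ] boxSpace L v :=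
  (walk (boxCoin L v C) ω).restrict (boxSpace_invariant L v C ω)

/-- The resolvent `(U - z)⁻¹` of the boxed walk (it is `0` if `z` is in the spectrum). -/
noncomputable def boxResolvent (L : ℕ × ℕ) (v : ℤ × ℤ) (C : Matrix.unitaryGroup (Fin 3) ℂ)
    (ω : Site → ℝ) (z : ℂ) : boxSpace L v →L[ℂ] boxSpace L v :=
  Ring.inverse (boxWalk L v C ω - z • ContinuousLinearMap.id ℂ (boxSpace L v))

/-- The size `|L|` of a box. -/
noncomputable def boxSize (L : ℕ × ℕ) : ℝ := √((L.1 : ℝ) ^ 2 + (L.2 : ℝ) ^ 2)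

/-! ### The randomness -/

/-- The uniform distribution on the torus, viewed as the interval `[0, 2π)`. -/
noncomputable def uniformPhase : Measure ℝ := ProbabilityTheory.cond volume (Set.Ico 0 (2 * Real.pi))

instance : IsProbabilityMeasure uniformPhase := by
  refine cond_isProbabilityMeasure_of_finite ?_ ?_ <;> simp [Real.pi_pos, ENNReal.mul_eq_top]

/-- The joint law of independent phases `ω_x`, one for each site, uniform on the torus. -/
noncomputable def disorder : Measure (Site → ℝ) := Measure.infinitePi fun _ : Site => uniformPhase

end HexWalk

namespace HexWalk

/-! ### Averaging over the phases -/

/-! Coin `C₀` is a permutation matrix, and for it the walk permutes the basis vectors up to phases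
with orbits of length six, the cells. Its sixth power is therefore diagonal, with value `e^{iθ}` on
a cell, where `θ` is three times the phase of the `A` site plus the phases of the three `B` sites it
meets. Matrix elements of its resolvent between different cells vanish, and for `C` near `C₀` they
should be small except near a resonance.

Off resonance: factoring `U₀⁶ - z⁶ = G (U₀ - z)` with `‖G‖ ≤ 6 max(1, |z|)⁵` shows that if every
`e^{iθ}` of the box keeps distance `6 max(1, |z|)⁵ η` from `z⁶`, then `U₀ - z` is bounded below by
`η` on the box. A perturbation of size `δ` in the coins then gives off-diagonal elements of size at
most `6δ/η²` (`norm_resolvent_coord_le`). A resonance has probability at most a constant times `|L|²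
η`, since each `θ` contains a phase with coefficient one (`disorder_resonant_le`).

On resonance: fractional moments of order below one are bounded uniformly in the box, `C` and `z`
(`lintegral_greenAbs_rpow_le`). Shifting the phases at `x` and `y` by a common `t` replaces `U` by
`A(w) U`, where `w = e^{it}` and `A(w)` is `w` on the range of a projection `Q` and `1` on its
kernel. A Cayley transform of the resolvent is holomorphic in `w` on the disc, and its diagonal
elements have positive real part, so Kolmogorov's inequality bounds their `s`-moments on the circle;
polarization reaches the remaining elements.

Hölder's inequality with exponents `q = p/(p-1)` and `p` joins the two parts: the resonant event
costs its probability to the power `1/p` times a moment of order `s q`, and `s q < 1` is exactly `p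
> 1/(1-s)`. With `η = |L|^{-(ap+2)}` and `δ = η² |L|^{-a/s}` both contributions decay like
`|L|^{-a}`. -/

instance : Finite Sublattice :=
  Finite.of_injective (fun t : Sublattice => (match t with | .A => true | .B => false : Bool))
    (by rintro (_ | _) (_ | _) <;> simp)

theorem lintegral_uniformPhase (g : ℝ → ENNReal) :
    ∫⁻ t, g t ∂uniformPhase =
      (ENNReal.ofReal (2 * Real.pi))⁻¹ * ∫⁻ t in Set.Ioc 0 (2 * Real.pi), g t := by
  rw [uniformPhase, ProbabilityTheory.cond, lintegral_smul_measure, Real.volume_Ico, sub_zero,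
    restrict_Ico_eq_restrict_Ioc, smul_eq_mul]

theorem lintegral_uniformPhase_of_periodic {g : ℝ → ENNReal}
    (hp : Function.Periodic g (2 * Real.pi)) (t : ℝ) :
    ∫⁻ x, g x ∂uniformPhase =
      (ENNReal.ofReal (2 * Real.pi))⁻¹ * ∫⁻ x in Set.Ioc t (t + 2 * Real.pi), g x := by
  have : Fact (0 < 2 * Real.pi) := ⟨Real.two_pi_pos⟩
  have h1 := AddCircle.lintegral_preimage (2 * Real.pi) t hp.lift
  have h2 := AddCircle.lintegral_preimage (2 * Real.pi) 0 hp.lift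
  simp only [Function.Periodic.lift_coe, zero_add] at h1 h2
  rw [lintegral_uniformPhase, h1, h2]

theorem lintegral_uniformPhase_add {g : ℝ → ENNReal}
    (hp : Function.Periodic g (2 * Real.pi)) (c : ℝ) :
    ∫⁻ x, g (x + c) ∂uniformPhase = ∫⁻ x, g x ∂uniformPhase := by
  rw [lintegral_uniformPhase_of_periodic hp c, lintegral_uniformPhase]
  congr 1
  have h := (measurePreserving_add_right volume c).setLIntegral_comp_emb
    (measurableEmbedding_addRight c) g (Set.Ioc 0 (2 * Real.pi))
  rw [h, Set.image_add_const_Ioc, zero_add, add_comm c]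

theorem ae_uniformPhase_mem : ∀ᵐ t ∂uniformPhase, t ∈ Set.Ico 0 (2 * Real.pi) :=
  ae_cond_mem measurableSet_Ico

theorem measurable_toIcoMod : Measurable (toIcoMod Real.two_pi_pos (0 : ℝ)) := by
  have : toIcoMod Real.two_pi_pos (0 : ℝ) =
      fun x => x - (⌊(x - 0) / (2 * Real.pi)⌋ : ℤ) • (2 * Real.pi) := by
    ext x
    rw [toIcoMod, toIcoDiv_eq_floor]
  rw [this]
  simp only [zsmul_eq_mul]
  fun_prop

/-- Rotation invariance of the uniform law on the circle. Since the phases live in an interval of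
`ℝ`, a shifted phase has to be reduced modulo `2π` before the laws can agree. -/
theorem map_uniformPhase (c : ℝ) :
    uniformPhase.map (fun t => toIcoMod Real.two_pi_pos (0 : ℝ) (t + c)) = uniformPhase := by
  have hm : Measurable fun t : ℝ => toIcoMod Real.two_pi_pos (0 : ℝ) (t + c) :=
    measurable_toIcoMod.comp (measurable_add_const c)
  ext s hs
  rw [← lintegral_indicator_one hs, ← lintegral_indicator_one hs,
    lintegral_map (measurable_one.indicator hs) hm]
  have hp : Function.Periodic
      (fun t => s.indicator (1 : ℝ → ENNReal) (toIcoMod Real.two_pi_pos (0 : ℝ) t))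
      (2 * Real.pi) := fun t => by
    simp only [toIcoMod_add_right]
  rw [lintegral_uniformPhase_add hp c]
  refine lintegral_congr_ae ?_
  filter_upwards [ae_uniformPhase_mem] with t ht
  rw [(toIcoMod_eq_self Real.two_pi_pos).2 (by simpa using ht)]

theorem map_disorder (c : Site → ℝ) :
    disorder.map (fun ω x => toIcoMod Real.two_pi_pos (0 : ℝ) (ω x + c x)) = disorder := by
  have h := Measure.infinitePi_map_pi (fun _ : Site => uniformPhase)
    (f := fun x t => toIcoMod Real.two_pi_pos (0 : ℝ) (t + c x))
    (fun x => measurable_toIcoMod.comp (measurable_add_const (c x)))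
  rw [disorder, h]
  simp only [map_uniformPhase]

theorem exp_toIcoMod (t : ℝ) :
    Complex.exp (Complex.I * toIcoMod Real.two_pi_pos (0 : ℝ) t) = Complex.exp (Complex.I * t) := by
  rw [Complex.exp_eq_exp_iff_exists_int]
  refine ⟨-toIcoDiv Real.two_pi_pos 0 t, ?_⟩
  rw [toIcoMod, zsmul_eq_mul]
  push_cast
  ring

/-- The function `g` of the phases depends only on the numbers `e^{i ω_x}`. -/
def DependsOnPhase {α : Type*} (g : (Site → ℝ) → α) : Prop :=
  ∀ ω ω' : Site → ℝ,
    (∀ x, Complex.exp (Complex.I * ω x) = Complex.exp (Complex.I * ω' x)) → g ω = g ω'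

theorem lintegral_disorder_add {g : (Site → ℝ) → ENNReal} (hm : Measurable g)
    (hg : DependsOnPhase g) (c : Site → ℝ) :
    ∫⁻ ω, g (ω + c) ∂disorder = ∫⁻ ω, g ω ∂disorder := by
  have hmeas : Measurable fun (ω : Site → ℝ) x =>
      toIcoMod Real.two_pi_pos (0 : ℝ) (ω x + c x) :=
    measurable_pi_lambda _ fun x => by
      have hx : Measurable fun ω : Site → ℝ => ω x := measurable_pi_apply x
      exact measurable_toIcoMod.comp (hx.add_const (c x))
  nth_rewrite 2 [← map_disorder c]
  rw [lintegral_map hm hmeas]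
  refine lintegral_congr fun ω => hg _ _ fun x => ?_
  rw [exp_toIcoMod]
  rfl

instance : IsProbabilityMeasure disorder := by
  unfold disorder
  infer_instance

/-- A bound on the average over a common phase shift at the sites of `S` bounds the
expectation. -/
theorem lintegral_disorder_le {g : (Site → ℝ) → ENNReal} (hm : Measurable g)
    (hg : DependsOnPhase g) (S : Set Site) {K : ENNReal}
    (hK : ∀ ω, ∫⁻ t, g (ω + S.indicator fun _ => t) ∂uniformPhase ≤ K) :
    ∫⁻ ω, g ω ∂disorder ≤ K := by
  classical
  have hm2 : Measurable fun q : ℝ × (Site → ℝ) => g (q.2 + S.indicator fun _ => q.1) := by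
    refine hm.comp (measurable_snd.add (measurable_pi_lambda _ fun x => ?_))
    by_cases hx : x ∈ S
    · simpa [hx] using measurable_fst
    · simp [hx]
  -- A superfluous average over `t` is inserted: for each fixed `t` the shift leaves the expectation
  -- unchanged. After exchanging the integrals, the average over `t` is the inner one and is bounded
  -- by `K` at each `ω`.
  calc ∫⁻ ω, g ω ∂disorder
      = ∫⁻ t, ∫⁻ ω, g (ω + S.indicator fun _ => t) ∂disorder ∂uniformPhase := by
        simp only [lintegral_disorder_add hm hg, lintegral_const, measure_univ, mul_one]
    _ = ∫⁻ ω, ∫⁻ t, g (ω + S.indicator fun _ => t) ∂uniformPhase ∂disorder :=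
        lintegral_lintegral_swap hm2.aemeasurable
    _ ≤ ∫⁻ _, K ∂disorder := lintegral_mono hK
    _ = K := by simp

/-- Two points of the unit circle within `η` of `w` are less than `2η` apart, hence at angular
distance at most `πη` by Jordan's inequality. The admissible angles thus lie in an interval of
length `2πη` out of `2π`. -/
theorem uniformPhase_norm_sub_lt_le (w : ℂ) (η : ℝ) :
    uniformPhase {t | ‖Complex.exp (Complex.I * t) - w‖ < η} ≤ ENNReal.ofReal η := by
  by_cases hne : ∃ t₀ : ℝ, ‖Complex.exp (Complex.I * t₀) - w‖ < η
  swap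
  · push Not at hne
    have : {t : ℝ | ‖Complex.exp (Complex.I * t) - w‖ < η} = ∅ := by
      ext t
      simpa using hne t
    simp [this]
  obtain ⟨t₀, ht₀⟩ := hne
  have hη : 0 < η := (norm_nonneg _).trans_lt ht₀
  set A : Set ℝ := {t | ‖Complex.exp (Complex.I * t) - w‖ < η} with hA
  have hAm : MeasurableSet A :=
    (isOpen_lt (by fun_prop) continuous_const).measurableSet
  have hper : Function.Periodic (A.indicator (1 : ℝ → ENNReal)) (2 * Real.pi) := fun t => by
    have : t + 2 * Real.pi ∈ A ↔ t ∈ A := by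
      simp only [hA, Set.mem_ofPred_eq]
      rw [show Complex.exp (Complex.I * ((t + 2 * Real.pi : ℝ) : ℂ)) =
        Complex.exp (Complex.I * t) by
          push_cast
          rw [mul_add, show Complex.I * (2 * (Real.pi : ℂ)) = 2 * Real.pi * Complex.I by ring]
          exact Complex.exp_periodic _]
    simp [Set.indicator_apply, this]
  -- The period is centred at `t₀` so that `|t - t₀| / 2 ≤ π / 2`, the range in which Jordan's
  -- inequality holds.
  rw [← lintegral_indicator_one hAm, lintegral_uniformPhase_of_periodic hper (t₀ - Real.pi),
    lintegral_indicator_one hAm]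
  have hsub : A ∩ Set.Ioc (t₀ - Real.pi) (t₀ - Real.pi + 2 * Real.pi) ⊆
      Set.Icc (t₀ - Real.pi * η) (t₀ + Real.pi * η) := by
    rintro t ⟨ht, h1, h2⟩
    have hd : ‖Complex.exp (Complex.I * ((t - t₀ : ℝ) : ℂ)) - 1‖ < 2 * η := by
      have : Complex.exp (Complex.I * t) - Complex.exp (Complex.I * t₀) =
          Complex.exp (Complex.I * t₀) * (Complex.exp (Complex.I * ((t - t₀ : ℝ) : ℂ)) - 1) := by
        rw [mul_sub, ← Complex.exp_add, mul_one]
        congr 2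
        push_cast
        ring
      have hn : ‖Complex.exp (Complex.I * t) - Complex.exp (Complex.I * t₀)‖ < 2 * η := by
        calc _ = ‖(Complex.exp (Complex.I * t) - w) - (Complex.exp (Complex.I * t₀) - w)‖ := by
              congr 1; ring
          _ ≤ _ := norm_sub_le _ _
          _ < _ := by
              have : ‖Complex.exp (Complex.I * t) - w‖ < η := ht
              linarith
      rwa [this, norm_mul, Complex.norm_exp_I_mul_ofReal, one_mul] at hn
    rw [Complex.norm_exp_I_mul_ofReal_sub_one, Real.norm_eq_abs, abs_mul, abs_two] at hd
    have hs : 2 / Real.pi * |(t - t₀) / 2| ≤ |Real.sin ((t - t₀) / 2)| := by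
      refine Real.mul_abs_le_abs_sin ?_
      rw [abs_le]
      constructor <;> linarith
    have h3 : |t - t₀| ≤ Real.pi * η := by
      rw [abs_div, abs_two] at hs
      have h4 : |t - t₀| / Real.pi ≤ |Real.sin ((t - t₀) / 2)| := by
        refine le_trans (le_of_eq ?_) hs
        ring
      rw [div_le_iff₀ Real.pi_pos] at h4
      nlinarith [Real.pi_pos]
    rw [abs_le] at h3
    constructor <;> linarith
  calc _ ≤ (ENNReal.ofReal (2 * Real.pi))⁻¹ *
        volume (Set.Icc (t₀ - Real.pi * η) (t₀ + Real.pi * η)) := by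
        refine mul_le_mul_right ?_ _
        rw [Measure.restrict_apply hAm]
        exact measure_mono hsub
    _ = (ENNReal.ofReal (2 * Real.pi))⁻¹ * (ENNReal.ofReal (2 * Real.pi) * ENNReal.ofReal η) := by
        rw [Real.volume_Icc, ← ENNReal.ofReal_mul Real.two_pi_pos.le]
        congr 2
        ring
    _ = ENNReal.ofReal η := by
        rw [← mul_assoc, ENNReal.inv_mul_cancel (by simp [Real.pi_pos])
          ENNReal.ofReal_ne_top, one_mul]

/-! ### Kolmogorov's inequality -/

/-- Kolmogorov's inequality for holomorphic functions with positive real part. -/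
theorem circleAverage_norm_rpow_le {F : ℂ → ℂ} (hF : DiffContOnCl ℂ F (Metric.ball 0 1))
    (hpos : ∀ w ∈ Metric.closedBall (0 : ℂ) 1, 0 < (F w).re) {s : ℝ} (hs0 : 0 < s) (hs1 : s < 1) :
    Real.circleAverage (fun w => ‖F w‖ ^ s) 0 1 ≤ ‖F 0‖ ^ s / Real.cos (Real.pi / 2 * s) := by
  have hcos : 0 < Real.cos (Real.pi / 2 * s) :=
    Real.cos_pos_of_mem_Ioo ⟨by nlinarith [Real.pi_pos], by nlinarith [Real.pi_pos]⟩
  have hcl : closure (Metric.ball (0 : ℂ) 1) = Metric.closedBall 0 1 :=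
    closure_ball 0 one_ne_zero
  have hFc : ContinuousOn F (Metric.closedBall 0 1) := hcl ▸ hF.continuousOn
  have hslit : ∀ w ∈ Metric.closedBall (0 : ℂ) 1, F w ∈ Complex.slitPlane := fun w hw =>
    Or.inl (hpos w hw)
  have hG : DiffContOnCl ℂ (fun w => F w ^ (s : ℂ)) (Metric.ball 0 1) := by
    refine ⟨hF.differentiableOn.cpow_const fun w hw => hslit w (Metric.ball_subset_closedBall hw),
      ?_⟩
    rw [hcl]
    exact hFc.cpow_const fun w hw => hslit w hw
  have hGc : ContinuousOn (fun w => F w ^ (s : ℂ)) (Metric.sphere 0 |1|) := by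
    rw [abs_one]
    exact (hFc.cpow_const fun w hw => hslit w hw).mono Metric.sphere_subset_closedBall
  have hGi : CircleIntegrable (fun w => F w ^ (s : ℂ)) 0 1 := hGc.circleIntegrable'
  have hmean : Real.circleAverage (fun w => F w ^ (s : ℂ)) 0 1 = F 0 ^ (s : ℂ) :=
    DiffContOnCl.circleAverage (by rwa [abs_one])
  -- The mean value property for the harmonic function `Re Fˢ`, which makes sense because `F` avoids
  -- the branch cut.
  have hre : Real.circleAverage (fun w => (F w ^ (s : ℂ)).re) 0 1 = (F 0 ^ (s : ℂ)).re := by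
    rw [← hmean]
    exact Complex.reCLM.circleAverage_comp_comm hGi
  have hnorm : ∀ w ∈ Metric.closedBall (0 : ℂ) 1, ‖F w ^ (s : ℂ)‖ = ‖F w‖ ^ s := fun w hw => by
    rw [Complex.norm_cpow_of_ne_zero (Complex.slitPlane_ne_zero (hslit w hw))]
    simp
  -- Positive real part means `|arg F| < π/2`, so `arg Fˢ = s arg F` stays within `πs/2`, and `Re
  -- Fˢ` controls `|F|ˢ` up to the factor `cos(πs/2) > 0`.
  have hlow : ∀ w ∈ Metric.closedBall (0 : ℂ) 1,
      ‖F w‖ ^ s * Real.cos (Real.pi / 2 * s) ≤ (F w ^ (s : ℂ)).re := fun w hw => by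
    have hne := Complex.slitPlane_ne_zero (hslit w hw)
    have harg : |Complex.arg (F w)| < Real.pi / 2 :=
      Complex.abs_arg_lt_pi_div_two_iff.2 (Or.inl (hpos w hw))
    rw [← Complex.norm_mul_cos_arg (F w ^ (s : ℂ)), hnorm w hw]
    have h1 : Complex.arg (F w ^ (s : ℂ)) = s * Complex.arg (F w) := by
      rw [Complex.cpow_def_of_ne_zero hne, Complex.arg_exp, (toIocMod_eq_self _).2]
      · simp [Complex.log_im, mul_comm]
      · rw [abs_lt] at harg
        simp only [Complex.mul_im, Complex.log_im, Complex.log_re, Complex.ofReal_im,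
          Complex.ofReal_re, mul_zero, zero_add]
        constructor <;> nlinarith [Real.pi_pos]
    rw [h1]
    refine mul_le_mul_of_nonneg_left ?_ (by positivity)
    rw [← Real.cos_abs (s * _), abs_mul, abs_of_pos hs0]
    refine Real.cos_le_cos_of_nonneg_of_le_pi (by positivity) ?_ ?_
    · nlinarith [Real.pi_pos]
    · nlinarith
  have hFi : CircleIntegrable (fun w => ‖F w‖ ^ s) 0 1 := by
    refine ContinuousOn.circleIntegrable' ?_
    rw [abs_one]
    exact ((hFc.mono Metric.sphere_subset_closedBall).norm).rpow_const fun _ _ => Or.inr hs0.le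
  rw [le_div_iff₀ hcos, mul_comm, ← smul_eq_mul, ← Real.circleAverage_fun_smul]
  calc Real.circleAverage (fun w => Real.cos (Real.pi / 2 * s) • ‖F w‖ ^ s) 0 1
      ≤ Real.circleAverage (fun w => (F w ^ (s : ℂ)).re) 0 1 := by
        refine Real.circleAverage_mono ?_ ?_ fun w hw => ?_
        · exact hFi.const_fun_smul
        · refine ContinuousOn.circleIntegrable' ?_
          exact Complex.continuous_re.comp_continuousOn hGc
        · rw [abs_one] at hw
          rw [smul_eq_mul, mul_comm]
          exact hlow w (Metric.sphere_subset_closedBall hw)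
    _ = (F 0 ^ (s : ℂ)).re := hre
    _ ≤ ‖F 0 ^ (s : ℂ)‖ := Complex.re_le_norm _
    _ = ‖F 0‖ ^ s := hnorm 0 (by simp)

/-! ### Fractional moments of resolvents of isometries -/

theorem rpow_add_le {a b s : ℝ} (ha : 0 ≤ a) (hb : 0 ≤ b) (hs0 : 0 < s) (hs1 : s < 1) :
    (a + b) ^ s ≤ a ^ s + b ^ s := by
  have := NNReal.rpow_add_le_add_rpow ⟨a, ha⟩ ⟨b, hb⟩ hs0.le hs1.le
  exact_mod_cast this

/-! ### Phase pencils and their Cayley transforms -/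

section FractionalMoment

variable {E : Type*} [NormedAddCommGroup E] [InnerProductSpace ℂ E]

theorem apply_inverse_apply {T : E →L[ℂ] E} (hT : IsUnit T) (u : E) :
    T (Ring.inverse T u) = u := by
  rw [← mul_apply_eq_comp, Ring.mul_inverse_cancel _ hT]
  rfl

theorem inverse_apply_eq {T : E →L[ℂ] E} (hT : IsUnit T) {u y : E} (h : T u = y) :
    Ring.inverse T y = u := by
  rw [← h, ← mul_apply_eq_comp, Ring.inverse_mul_cancel _ hT]
  rfl

/-- The operator acting as multiplication by `w` on the range of the projection `Q` and as the
identity on its kernel. -/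
noncomputable def phaseMix (Q : E →L[ℂ] E) (w : ℂ) : E →L[ℂ] E := 1 - Q + w • Q

variable {Q : E →L[ℂ] E}

theorem phaseMix_apply (w : ℂ) (u : E) : phaseMix Q w u = u - Q u + w • Q u := rfl

theorem phaseMix_apply_self {y : E} (hy : Q y = y) (w : ℂ) : phaseMix Q w y = w • y := by
  simp [phaseMix_apply, hy]

theorem inner_phaseMix (hQ : (Q : E →ₗ[ℂ] E).IsSymmetric) {x : E} (hx : Q x = x) (w : ℂ) (u : E) :
    inner ℂ x (phaseMix Q w u) = w * inner ℂ x u := by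
  have h : inner ℂ x (Q u) = inner ℂ x u := by
    have := hQ x u
    simp only [ContinuousLinearMap.coe_coe] at this
    rw [← this, hx]
  rw [phaseMix_apply, inner_add_right, inner_sub_right, inner_smul_right, h]
  ring

theorem phaseMix_phaseMix (hQ2 : Q * Q = Q) {w w' : ℂ} (hw : w * w' = 1) (u : E) :
    phaseMix Q w (phaseMix Q w' u) = u := by
  have h : ∀ u, Q (Q u) = Q u := fun u => DFunLike.congr_fun hQ2 u
  simp only [phaseMix_apply, map_add, map_sub, map_smul, h, smul_smul,
    sub_self, zero_add]
  rw [mul_comm w' w, hw, one_smul]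
  abel

theorem norm_phaseMix_apply_sq (hQ : (Q : E →ₗ[ℂ] E).IsSymmetric) (hQ2 : Q * Q = Q) (w : ℂ)
    (u : E) : ‖phaseMix Q w u‖ ^ 2 = ‖u - Q u‖ ^ 2 + ‖w‖ ^ 2 * ‖Q u‖ ^ 2 := by
  have h : inner ℂ (u - Q u) (w • Q u) = 0 := by
    have h1 := hQ (u - Q u) u
    have h2 : Q (Q u) = Q u := DFunLike.congr_fun hQ2 u
    simp only [ContinuousLinearMap.coe_coe, map_sub, h2, sub_self, inner_zero_left] at h1
    rw [inner_smul_right, ← h1, mul_zero]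
  rw [phaseMix_apply, @norm_add_sq ℂ, h, norm_smul]
  simp
  ring

theorem norm_phaseMix_apply_le (hQ : (Q : E →ₗ[ℂ] E).IsSymmetric) (hQ2 : Q * Q = Q) {w : ℂ}
    (hw : ‖w‖ ≤ 1) (u : E) : ‖phaseMix Q w u‖ ≤ ‖u‖ := by
  have h1 := norm_phaseMix_apply_sq hQ hQ2 w u
  have h2 := norm_phaseMix_apply_sq hQ hQ2 1 u
  rw [show phaseMix Q 1 u = u by simp [phaseMix_apply], norm_one] at h2
  refine (sq_le_sq₀ (norm_nonneg _) (norm_nonneg _)).1 ?_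
  rw [h1, h2]
  gcongr

variable [FiniteDimensional ℂ E]

theorem isUnit_of_forall_eq_zero {T : E →L[ℂ] E} (hT : ∀ u, T u = 0 → u = 0) : IsUnit T := by
  have : CompleteSpace E := FiniteDimensional.complete ℂ E
  have hinj : Function.Injective (T : E →ₗ[ℂ] E) :=
    (injective_iff_map_eq_zero (T : E →ₗ[ℂ] E)).2 hT
  exact ContinuousLinearMap.isUnit_iff_bijective.2
    ⟨hinj, LinearMap.injective_iff_surjective.1 hinj⟩

theorem continuousAt_inverse {T : E →L[ℂ] E} (hT : IsUnit T) : ContinuousAt Ring.inverse T := by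
  have : CompleteSpace E := FiniteDimensional.complete ℂ E
  exact (differentiableAt_inverse (𝕜 := ℂ) hT).continuousAt

variable {V : E →L[ℂ] E} {ζ : ℂ}

/-- On the closed disc `A(w)` is a contraction, so `ζ A(w)` strictly shrinks vectors while `V`
preserves their norm; the two cannot agree on a nonzero vector. -/
theorem isUnit_sub_smul_phaseMix (hQ : (Q : E →ₗ[ℂ] E).IsSymmetric) (hQ2 : Q * Q = Q)
    (hV : ∀ u, ‖V u‖ = ‖u‖) (hζ : ‖ζ‖ < 1) {w : ℂ} (hw : ‖w‖ ≤ 1) :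
    IsUnit (V - ζ • phaseMix Q w) := by
  refine isUnit_of_forall_eq_zero fun u hu => ?_
  have h1 : V u = ζ • phaseMix Q w u := sub_eq_zero.1 hu
  have h2 : ‖u‖ = ‖ζ‖ * ‖phaseMix Q w u‖ := by rw [← hV u, h1, norm_smul]
  have h3 := norm_phaseMix_apply_le hQ hQ2 hw u
  by_contra hne
  have h4 : 0 < ‖u‖ := norm_pos_iff.2 hne
  nlinarith [norm_nonneg ζ]

/-- The Cayley transform of the pencil `V - ζ A(w)`, up to a compression to the range of `Q`. -/
noncomputable def pencilCayley (V Q : E →L[ℂ] E) (ζ w : ℂ) : E →L[ℂ] E :=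
  1 + (2 * ζ * w) • Ring.inverse (V - ζ • phaseMix Q w)

theorem differentiableAt_pencilCayley (hQ : (Q : E →ₗ[ℂ] E).IsSymmetric) (hQ2 : Q * Q = Q)
    (hV : ∀ u, ‖V u‖ = ‖u‖) (hζ : ‖ζ‖ < 1) {w : ℂ} (hw : ‖w‖ ≤ 1) :
    DifferentiableAt ℂ (pencilCayley V Q ζ) w := by
  have : CompleteSpace E := FiniteDimensional.complete ℂ E
  have h1 : DifferentiableAt ℂ (fun w => V - ζ • phaseMix Q w) w := by
    unfold phaseMix
    fun_prop
  have h2 := (differentiableAt_inverse (𝕜 := ℂ)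
    (isUnit_sub_smul_phaseMix hQ hQ2 hV hζ hw)).comp w h1
  unfold pencilCayley
  exact (((differentiableAt_const (2 * ζ)).mul differentiableAt_id).smul h2).const_add _

theorem differentiableAt_inner_pencilCayley (hQ : (Q : E →ₗ[ℂ] E).IsSymmetric) (hQ2 : Q * Q = Q)
    (hV : ∀ u, ‖V u‖ = ‖u‖) (hζ : ‖ζ‖ < 1) (x y : E) {w : ℂ} (hw : ‖w‖ ≤ 1) :
    DifferentiableAt ℂ (fun w => inner ℂ x (pencilCayley V Q ζ w y)) w :=
  (innerSL ℂ x).differentiableAt.comp w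
    ((differentiableAt_pencilCayley hQ hQ2 hV hζ hw).clm_apply (differentiableAt_const y))

/-- With `u = (V - ζA(w))⁻¹ v`, the matrix element equals `⟨Vu - ζAu, Vu + ζAu⟩`, because pairing
with a vector in the range of `Q` turns `A(w)` into the scalar `w`. Its real part is `‖Vu‖² - ‖ζAu‖²
> 0`, and its value at `w = 0` is `‖v‖²`, so Kolmogorov's inequality applies. -/
theorem circleAverage_inner_self_pencilCayley_le (hQ : (Q : E →ₗ[ℂ] E).IsSymmetric)
    (hQ2 : Q * Q = Q) (hV : ∀ u, ‖V u‖ = ‖u‖) (hζ : ‖ζ‖ < 1) {v : E} (hv : Q v = v)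
    {s : ℝ} (hs0 : 0 < s) (hs1 : s < 1) :
    Real.circleAverage (fun w => ‖inner ℂ v (pencilCayley V Q ζ w v)‖ ^ s) 0 1 ≤
      (‖v‖ ^ 2) ^ s / Real.cos (Real.pi / 2 * s) := by
  rcases eq_or_ne v 0 with rfl | hv0
  · simp [Real.zero_rpow hs0.ne', Real.circleAverage_const]
  have hd : ∀ w : ℂ, ‖w‖ ≤ 1 → DifferentiableAt ℂ (fun w => inner ℂ v (pencilCayley V Q ζ w v)) w :=
    fun w hw => differentiableAt_inner_pencilCayley hQ hQ2 hV hζ v v hw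
  have hF : DiffContOnCl ℂ (fun w => inner ℂ v (pencilCayley V Q ζ w v)) (Metric.ball 0 1) := by
    refine DifferentiableOn.diffContOnCl fun w hw => (hd w ?_).differentiableWithinAt
    rw [closure_ball _ one_ne_zero] at hw
    simpa using hw
  refine (circleAverage_norm_rpow_le hF (fun w hw => ?_) hs0 hs1).trans (le_of_eq ?_)
  · have hw : ‖w‖ ≤ 1 := by simpa using hw
    have hu := isUnit_sub_smul_phaseMix hQ hQ2 hV hζ hw
    set u := Ring.inverse (V - ζ • phaseMix Q w) v with hu_def
    have hTu : V u - ζ • phaseMix Q w u = v := apply_inverse_apply hu v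
    have hval : inner ℂ v (pencilCayley V Q ζ w v) =
        inner ℂ (V u - ζ • phaseMix Q w u) (V u + ζ • phaseMix Q w u) := by
      have h1 : V u + ζ • phaseMix Q w u = v + (2 * ζ) • phaseMix Q w u := by
        rw [← hTu, mul_smul, two_smul]
        abel
      rw [h1, hTu, inner_add_right, inner_smul_right, inner_phaseMix hQ hv]
      change inner ℂ v (v + (2 * ζ * w) • u) = _
      rw [inner_add_right, inner_smul_right]
      ring
    have hre : (inner ℂ v (pencilCayley V Q ζ w v)).re =
        ‖V u‖ ^ 2 - ‖ζ • phaseMix Q w u‖ ^ 2 := by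
      rw [hval, inner_sub_left, inner_add_right, inner_add_right, ← inner_conj_symm
        (ζ • phaseMix Q w u) (V u)]
      simp only [inner_self_eq_norm_sq_to_K, Complex.sub_re, Complex.add_re, Complex.conj_re]
      norm_cast
      simp only [Complex.coe_algebraMap, Complex.ofReal_re]
      ring
    have hu0 : u ≠ 0 := by
      intro h
      rw [h] at hTu
      simp at hTu
      exact hv0 hTu.symm
    have hpos : 0 < ‖u‖ := norm_pos_iff.2 hu0
    rw [hre, hV, norm_smul, sub_pos, sq_lt_sq₀ (by positivity) (by positivity)]
    have := norm_phaseMix_apply_le hQ hQ2 hw u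
    nlinarith [norm_nonneg ζ]
  · simp [pencilCayley, inner_self_eq_norm_sq_to_K]

theorem circleIntegrable_inner_pencilCayley (hQ : (Q : E →ₗ[ℂ] E).IsSymmetric) (hQ2 : Q * Q = Q)
    (hV : ∀ u, ‖V u‖ = ‖u‖) (hζ : ‖ζ‖ < 1) (x y : E) {s : ℝ} (hs0 : 0 < s) :
    CircleIntegrable (fun w => ‖inner ℂ x (pencilCayley V Q ζ w y)‖ ^ s) 0 1 := by
  refine ContinuousOn.circleIntegrable' fun w hw => ?_
  have hw : ‖w‖ ≤ 1 := by
    rw [abs_one] at hw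
    simpa using (Metric.sphere_subset_closedBall hw)
  exact ((differentiableAt_inner_pencilCayley hQ hQ2 hV hζ x y
    hw).continuousAt.norm.rpow_const (Or.inr hs0.le)).continuousWithinAt

theorem circleAverage_inner_pencilCayley_le (hQ : (Q : E →ₗ[ℂ] E).IsSymmetric)
    (hQ2 : Q * Q = Q) (hV : ∀ u, ‖V u‖ = ‖u‖) (hζ : ‖ζ‖ < 1) {x y : E} (hx : Q x = x)
    (hy : Q y = y) (hx1 : ‖x‖ ≤ 1) (hy1 : ‖y‖ ≤ 1) {s : ℝ} (hs0 : 0 < s) (hs1 : s < 1) :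
    Real.circleAverage (fun w => ‖inner ℂ x (pencilCayley V Q ζ w y)‖ ^ s) 0 1 ≤
      16 / Real.cos (Real.pi / 2 * s) := by
  have hcos : 0 < Real.cos (Real.pi / 2 * s) :=
    Real.cos_pos_of_mem_Ioo ⟨by nlinarith [Real.pi_pos], by nlinarith [Real.pi_pos]⟩
  set Φ : E → ℂ → ℝ := fun v w => ‖inner ℂ v (pencilCayley V Q ζ w v)‖ ^ s with hΦ
  have hΦi : ∀ v, CircleIntegrable (Φ v) 0 1 := fun v =>
    circleIntegrable_inner_pencilCayley hQ hQ2 hV hζ v v hs0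
  -- The polarization vectors `y ± x` and `y ± ix` have norm at most `2`, so each contributes at
  -- most `4ˢ ≤ 4` over the cosine; the four together give the constant `16`.
  have hΦle : ∀ v, Q v = v → ‖v‖ ≤ 2 →
      Real.circleAverage (Φ v) 0 1 ≤ 4 / Real.cos (Real.pi / 2 * s) := fun v hv hv2 => by
    refine (circleAverage_inner_self_pencilCayley_le hQ hQ2 hV hζ hv hs0 hs1).trans ?_
    gcongr
    calc (‖v‖ ^ 2) ^ s ≤ (4 : ℝ) ^ s := by
          refine Real.rpow_le_rpow (by positivity) ?_ hs0.le
          nlinarith [norm_nonneg v]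
      _ ≤ (4 : ℝ) ^ (1 : ℝ) := Real.rpow_le_rpow_of_exponent_le (by norm_num) hs1.le
      _ = 4 := Real.rpow_one 4
  set v₁ := y + x
  set v₂ := y - x
  set v₃ := y + Complex.I • x
  set v₄ := y - Complex.I • x
  have hIx : ‖Complex.I • x‖ ≤ 1 := by rwa [norm_smul, Complex.norm_I, one_mul]
  have hle : ∀ w, ‖inner ℂ x (pencilCayley V Q ζ w y)‖ ^ s ≤
      Φ v₁ w + Φ v₂ w + Φ v₃ w + Φ v₄ w := fun w => by
    have hpol : ‖inner ℂ x (pencilCayley V Q ζ w y)‖ ≤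
        ‖inner ℂ v₁ (pencilCayley V Q ζ w v₁)‖ + ‖inner ℂ v₂ (pencilCayley V Q ζ w v₂)‖ +
        ‖inner ℂ v₃ (pencilCayley V Q ζ w v₃)‖ + ‖inner ℂ v₄ (pencilCayley V Q ζ w v₄)‖ := by
      have h := inner_map_polarization' (pencilCayley V Q ζ w : E →ₗ[ℂ] E) y x
      simp only [ContinuousLinearMap.coe_coe] at h
      rw [norm_inner_symm, h, norm_div, norm_inner_symm v₁, norm_inner_symm v₂,
        norm_inner_symm v₃, norm_inner_symm v₄]
      refine (div_le_self (norm_nonneg _) (by simp)).trans ?_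
      refine (norm_add_le _ _).trans (add_le_add ((norm_sub_le _ _).trans
        (add_le_add (norm_sub_le _ _) ?_)) ?_) <;> simp [v₃, v₄]
    refine (Real.rpow_le_rpow (norm_nonneg _) hpol hs0.le).trans ?_
    refine (rpow_add_le (by positivity) (by positivity) hs0 hs1).trans ?_
    gcongr
    refine (rpow_add_le (by positivity) (by positivity) hs0 hs1).trans ?_
    gcongr
    exact rpow_add_le (by positivity) (by positivity) hs0 hs1
  calc _ ≤ Real.circleAverage (fun w => Φ v₁ w + Φ v₂ w + Φ v₃ w + Φ v₄ w) 0 1 :=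
        Real.circleAverage_mono (circleIntegrable_inner_pencilCayley hQ hQ2 hV hζ x y hs0)
          ((((hΦi v₁).add (hΦi v₂)).add (hΦi v₃)).add (hΦi v₄)) fun w _ => hle w
    _ = Real.circleAverage (Φ v₁) 0 1 + Real.circleAverage (Φ v₂) 0 1 +
        Real.circleAverage (Φ v₃) 0 1 + Real.circleAverage (Φ v₄) 0 1 := by
        rw [← Real.circleAverage_add (hΦi v₁) (hΦi v₂),
          ← Real.circleAverage_add ((hΦi v₁).add (hΦi v₂)) (hΦi v₃),
          ← Real.circleAverage_add (((hΦi v₁).add (hΦi v₂)).add (hΦi v₃)) (hΦi v₄)]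
        rfl
    _ ≤ 4 / Real.cos (Real.pi / 2 * s) + 4 / Real.cos (Real.pi / 2 * s) +
        4 / Real.cos (Real.pi / 2 * s) + 4 / Real.cos (Real.pi / 2 * s) := by
        refine add_le_add (add_le_add (add_le_add (hΦle _ ?_ ?_) (hΦle _ ?_ ?_)) (hΦle _ ?_ ?_))
          (hΦle _ ?_ ?_)
        · simp [v₁, hx, hy]
        · exact (norm_add_le _ _).trans (by linarith)
        · simp [v₂, hx, hy]
        · exact (norm_sub_le _ _).trans (by linarith)
        · simp [v₃, hx, hy]
        · exact (norm_add_le _ _).trans (by linarith)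
        · simp [v₄, hx, hy]
        · exact (norm_sub_le _ _).trans (by linarith)
    _ = _ := by ring

theorem continuousAt_inner_inverse (hQ : (Q : E →ₗ[ℂ] E).IsSymmetric) (hQ2 : Q * Q = Q)
    (hV : ∀ u, ‖V u‖ = ‖u‖) (hζ : ‖ζ‖ < 1) (x y : E) {s : ℝ} (hs0 : 0 < s) {w : ℂ}
    (hw : ‖w‖ ≤ 1) :
    ContinuousAt (fun w => ‖ζ * inner ℂ x (Ring.inverse (V - ζ • phaseMix Q w) y)‖ ^ s) w := by
  have : CompleteSpace E := FiniteDimensional.complete ℂ E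
  have h1 : DifferentiableAt ℂ (fun w => V - ζ • phaseMix Q w) w := by
    unfold phaseMix
    fun_prop
  have h2 := (differentiableAt_inverse (𝕜 := ℂ)
    (isUnit_sub_smul_phaseMix hQ hQ2 hV hζ hw)).comp w h1
  have h3 := (innerSL ℂ x).differentiableAt.comp w (h2.clm_apply (differentiableAt_const y))
  exact (h3.continuousAt.const_mul ζ).norm.rpow_const (Or.inr hs0.le)

theorem circleIntegrable_inner_inverse (hQ : (Q : E →ₗ[ℂ] E).IsSymmetric) (hQ2 : Q * Q = Q)
    (hV : ∀ u, ‖V u‖ = ‖u‖) (hζ : ‖ζ‖ < 1) (x y : E) {s : ℝ} (hs0 : 0 < s) :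
    CircleIntegrable
      (fun w => ‖ζ * inner ℂ x (Ring.inverse (V - ζ • phaseMix Q w) y)‖ ^ s) 0 1 := by
  refine ContinuousOn.circleIntegrable' fun w hw => ?_
  have hw : ‖w‖ = 1 := by simpa using hw
  exact (continuousAt_inner_inverse hQ hQ2 hV hζ x y hs0 hw.le).continuousWithinAt

theorem circleAverage_inner_inverse_le (hQ : (Q : E →ₗ[ℂ] E).IsSymmetric)
    (hQ2 : Q * Q = Q) (hV : ∀ u, ‖V u‖ = ‖u‖) (hζ : ‖ζ‖ < 1) {x y : E} (hx : Q x = x)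
    (hy : Q y = y) (hx1 : ‖x‖ ≤ 1) (hy1 : ‖y‖ ≤ 1) {s : ℝ} (hs0 : 0 < s) (hs1 : s < 1) :
    Real.circleAverage
      (fun w => ‖ζ * inner ℂ x (Ring.inverse (V - ζ • phaseMix Q w) y)‖ ^ s) 0 1 ≤
      16 / Real.cos (Real.pi / 2 * s) + 1 := by
  have hi := circleIntegrable_inner_pencilCayley hQ hQ2 hV hζ x y hs0
  have hc : CircleIntegrable (fun _ : ℂ => (1 : ℝ)) 0 1 := circleIntegrable_const _ _ _
  calc _ ≤ Real.circleAverage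
        (fun w => ‖inner ℂ x (pencilCayley V Q ζ w y)‖ ^ s + 1) 0 1 := by
        refine Real.circleAverage_mono (circleIntegrable_inner_inverse hQ hQ2 hV hζ x y hs0)
          (hi.add hc) fun w hw => ?_
        have hw : ‖w‖ = 1 := by simpa using hw
        have h1 : inner ℂ x (pencilCayley V Q ζ w y) = inner ℂ x y +
            2 * w * (ζ * inner ℂ x (Ring.inverse (V - ζ • phaseMix Q w) y)) := by
          change inner ℂ x (y + (2 * ζ * w) • (Ring.inverse (V - ζ • phaseMix Q w) y)) = _
          rw [inner_add_right, inner_smul_right]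
          ring
        have h2 : ‖inner ℂ x y‖ ≤ 1 :=
          (norm_inner_le_norm x y).trans (mul_le_one₀ hx1 (norm_nonneg _) hy1)
        set g := ζ * inner ℂ x (Ring.inverse (V - ζ • phaseMix Q w) y)
        -- On the circle `|w| = 1`, so removing the identity from the Cayley transform recovers the
        -- pencil's inverse at the cost of `|⟨x, y⟩| ≤ 1`.
        have h3 : 2 * ‖g‖ ≤ ‖inner ℂ x (pencilCayley V Q ζ w y)‖ + 1 := by
          calc 2 * ‖g‖ = ‖2 * w * g‖ := by simp [hw]
            _ = ‖inner ℂ x (pencilCayley V Q ζ w y) - inner ℂ x y‖ := by rw [h1]; congr 1; ring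
            _ ≤ _ := (norm_sub_le _ _).trans (by gcongr)
        calc ‖g‖ ^ s ≤ (‖inner ℂ x (pencilCayley V Q ζ w y)‖ + 1) ^ s := by
              refine Real.rpow_le_rpow (norm_nonneg _) ?_ hs0.le
              linarith [norm_nonneg g]
          _ ≤ ‖inner ℂ x (pencilCayley V Q ζ w y)‖ ^ s + 1 ^ s :=
              rpow_add_le (norm_nonneg _) zero_le_one hs0 hs1
          _ = _ := by rw [Real.one_rpow]
    _ = Real.circleAverage (fun w => ‖inner ℂ x (pencilCayley V Q ζ w y)‖ ^ s) 0 1 + 1 := by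
        rw [Real.circleAverage_fun_add hi hc, Real.circleAverage_const]
    _ ≤ _ := by
        gcongr
        exact circleAverage_inner_pencilCayley_le hQ hQ2 hV hζ hx hy hx1 hy1 hs0 hs1

end FractionalMoment

theorem lintegral_uniformPhase_exp {f : ℂ → ℝ} (hf : CircleIntegrable f 0 1) (h0 : ∀ w, 0 ≤ f w) :
    ∫⁻ t, ENNReal.ofReal (f (Complex.exp (Complex.I * t))) ∂uniformPhase =
      ENNReal.ofReal (Real.circleAverage f 0 1) := by
  have hi : IntervalIntegrable (fun t => f (circleMap 0 1 t)) volume 0 (2 * Real.pi) := hf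
  rw [intervalIntegrable_iff_integrableOn_Ioc_of_le Real.two_pi_pos.le] at hi
  rw [lintegral_uniformPhase, Real.circleAverage_def,
    intervalIntegral.integral_of_le Real.two_pi_pos.le, smul_eq_mul,
    ENNReal.ofReal_mul (p := (2 * Real.pi)⁻¹) (by positivity), ENNReal.ofReal_inv_of_pos Real.two_pi_pos,
    ofReal_integral_eq_lintegral_ofReal hi (ae_of_all _ fun t => h0 _)]
  simp only [circleMap, Complex.ofReal_one, one_mul, zero_add, mul_comm Complex.I]

/-! ### From the pencil to the resolvent of `A(w) U` -/

section FractionalMoment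

variable {E : Type*} [NormedAddCommGroup E] [InnerProductSpace ℂ E] {U Q : E →L[ℂ] E} {z : ℂ}

theorem abs_sub_mul_norm_le (hU : ∀ u, ‖U u‖ = ‖u‖) (z : ℂ) (u : E) :
    |1 - ‖z‖| * ‖u‖ ≤ ‖(U - z • ContinuousLinearMap.id ℂ E) u‖ := by
  have h : |‖U u‖ - ‖z • u‖| ≤ ‖U u - z • u‖ := abs_norm_sub_norm_le _ _
  rw [hU, norm_smul, ← one_sub_mul, abs_mul, abs_norm] at h
  exact h

theorem norm_phaseMix_mul_apply (hQ : (Q : E →ₗ[ℂ] E).IsSymmetric) (hQ2 : Q * Q = Q)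
    (hU : ∀ u, ‖U u‖ = ‖u‖) {w : ℂ} (hw : ‖w‖ = 1) (u : E) : ‖(phaseMix Q w * U) u‖ = ‖u‖ := by
  refine le_antisymm ((norm_phaseMix_apply_le hQ hQ2 hw.le (U u)).trans (hU u).le) ?_
  have hw' : w⁻¹ * w = 1 := inv_mul_cancel₀ (norm_ne_zero_iff.1 (by rw [hw]; exact one_ne_zero))
  have h := norm_phaseMix_apply_le hQ hQ2 (w := w⁻¹) (by rw [norm_inv, hw, inv_one])
    (phaseMix Q w (U u))
  rwa [phaseMix_phaseMix hQ2 hw', hU] at h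

variable [FiniteDimensional ℂ E]

theorem isUnit_sub_smul_id (hU : ∀ u, ‖U u‖ = ‖u‖) (hz : ‖z‖ ≠ 1) :
    IsUnit (U - z • ContinuousLinearMap.id ℂ E) := by
  refine isUnit_of_forall_eq_zero fun u hu => ?_
  have h := abs_sub_mul_norm_le hU z u
  rw [hu, norm_zero] at h
  have h1 : 0 < |1 - ‖z‖| := abs_pos.2 (sub_ne_zero.2 hz.symm)
  exact norm_le_zero_iff.1 (nonpos_of_mul_nonpos_right h h1)

theorem norm_inverse_sub_smul_id_le (hU : ∀ u, ‖U u‖ = ‖u‖) (hz : ‖z‖ ≠ 1) (y : E) :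
    ‖Ring.inverse (U - z • ContinuousLinearMap.id ℂ E) y‖ ≤ ‖y‖ / |1 - ‖z‖| := by
  have h := abs_sub_mul_norm_le hU z (Ring.inverse (U - z • ContinuousLinearMap.id ℂ E) y)
  rw [apply_inverse_apply (isUnit_sub_smul_id hU hz)] at h
  rwa [le_div_iff₀ (abs_pos.2 (sub_ne_zero.2 hz.symm)), mul_comm]

/-- The factorization `A(w) U - z = A(w) (U - z A(w⁻¹))` reduces the resolvent to a pencil with
parameter inside the disc. The leftover factor `A(w⁻¹)` acts on `y` as a phase. -/
theorem norm_inner_resolvent_of_norm_lt_one (hQ : (Q : E →ₗ[ℂ] E).IsSymmetric) (hQ2 : Q * Q = Q)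
    (hU : ∀ u, ‖U u‖ = ‖u‖) (hz : ‖z‖ < 1) (x : E) {y : E} (hy : Q y = y)
    {w : ℂ} (hw : ‖w‖ = 1) :
    ‖inner ℂ x (Ring.inverse (phaseMix Q w * U - z • ContinuousLinearMap.id ℂ E) y)‖ =
      ‖inner ℂ x (Ring.inverse (U - z • phaseMix Q w⁻¹) y)‖ := by
  have hw0 : w ≠ 0 := norm_ne_zero_iff.1 (by rw [hw]; exact one_ne_zero)
  have hw' : ‖w⁻¹‖ = 1 := by rw [norm_inv, hw, inv_one]
  have hunit := isUnit_sub_smul_phaseMix hQ hQ2 hU hz hw'.le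
  have h1 := apply_inverse_apply hunit y
  set u := Ring.inverse (U - z • phaseMix Q w⁻¹) y
  have h2 : (phaseMix Q w * U - z • ContinuousLinearMap.id ℂ E) (w⁻¹ • u) = y := by
    have h3 : phaseMix Q w (U u - z • phaseMix Q w⁻¹ u) = phaseMix Q w y := congrArg _ h1
    rw [map_sub, map_smul, phaseMix_phaseMix hQ2 (mul_inv_cancel₀ hw0),
      phaseMix_apply_self hy] at h3
    rw [map_smul]
    change w⁻¹ • (phaseMix Q w (U u) - z • u) = y
    rw [h3, smul_smul, inv_mul_cancel₀ hw0, one_smul]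
  rw [inverse_apply_eq (isUnit_sub_smul_id (norm_phaseMix_mul_apply hQ hQ2 hU hw) hz.ne) h2,
    inner_smul_right, norm_mul, hw', one_mul]

/-- For `|z| > 1` the isometry is inverted instead: with `V = U⁻¹` and `u = (V - z⁻¹A(w))⁻¹ y`, the
solution is `-z⁻¹ V u`, and `V u = y + z⁻¹ A(w) u` brings in only `⟨x, y⟩` and the pencil's matrix
element. -/
theorem norm_inner_resolvent_le_of_one_lt_norm (hQ : (Q : E →ₗ[ℂ] E).IsSymmetric)
    (hQ2 : Q * Q = Q) (hU : ∀ u, ‖U u‖ = ‖u‖) (hz : 1 < ‖z‖) {V : E →L[ℂ] E}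
    (hUV : U * V = 1) (hV : ∀ u, ‖V u‖ = ‖u‖) {x y : E} (hx : Q x = x) (hx1 : ‖x‖ ≤ 1)
    (hy1 : ‖y‖ ≤ 1) {w : ℂ} (hw : ‖w‖ = 1) :
    ‖inner ℂ x (Ring.inverse (phaseMix Q w * U - z • ContinuousLinearMap.id ℂ E) y)‖ ≤
      ‖z⁻¹ * inner ℂ x (Ring.inverse (V - z⁻¹ • phaseMix Q w) y)‖ + 1 := by
  have hz0 : z ≠ 0 := norm_pos_iff.1 (zero_lt_one.trans hz)
  have hζ : ‖z⁻¹‖ < 1 := by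
    rw [norm_inv]
    exact inv_lt_one_of_one_lt₀ hz
  have hunit := isUnit_sub_smul_phaseMix hQ hQ2 hV hζ hw.le
  have h1 := apply_inverse_apply hunit y
  set u := Ring.inverse (V - z⁻¹ • phaseMix Q w) y
  have hu : V u = y + z⁻¹ • phaseMix Q w u := by
    rw [← h1]
    change _ = V u - z⁻¹ • phaseMix Q w u + z⁻¹ • phaseMix Q w u
    rw [sub_add_cancel]
  have h2 : (phaseMix Q w * U - z • ContinuousLinearMap.id ℂ E) (-z⁻¹ • V u) = y := by
    have h3 : U (V u) = u := DFunLike.congr_fun hUV u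
    rw [map_smul]
    change -z⁻¹ • (phaseMix Q w (U (V u)) - z • V u) = y
    rw [h3, hu, smul_add, smul_smul, mul_inv_cancel₀ hz0, one_smul, add_comm, sub_add_cancel_left,
      neg_smul, smul_neg, neg_neg, smul_smul, inv_mul_cancel₀ hz0, one_smul]
  rw [inverse_apply_eq (isUnit_sub_smul_id (norm_phaseMix_mul_apply hQ hQ2 hU hw) hz.ne') h2, hu,
    inner_smul_right, inner_add_right, inner_smul_right, inner_phaseMix hQ hx, norm_mul, norm_neg]
  have h4 : ‖inner ℂ x y‖ ≤ 1 :=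
    (norm_inner_le_norm x y).trans (mul_le_one₀ hx1 (norm_nonneg _) hy1)
  have h5 : ‖inner ℂ x y + z⁻¹ * (w * inner ℂ x u)‖ ≤ 1 + ‖z⁻¹ * inner ℂ x u‖ := by
    refine (norm_add_le _ _).trans (add_le_add h4 (le_of_eq ?_))
    simp [hw]
  calc _ ≤ 1 * ‖inner ℂ x y + z⁻¹ * (w * inner ℂ x u)‖ := by gcongr
    _ ≤ _ := by linarith

/-- The bound for the fractional moments of order `s` of matrix elements of the resolvent. -/
noncomputable def momentBound (s : ℝ) : ℝ := 32 / Real.cos (Real.pi / 2 * s) + 2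

/-- The fractional moments of the matrix elements between vectors in the range of the projection
`Q` of the resolvent of `A(e^{it}) U`, where `A(w)` is `w` on the range of `Q` and `1` on its
kernel, are bounded uniformly in the isometry `U` and the spectral parameter `z`. -/
theorem lintegral_inner_resolvent_le (hQ : (Q : E →ₗ[ℂ] E).IsSymmetric) (hQ2 : Q * Q = Q)
    (hU : ∀ u, ‖U u‖ = ‖u‖) (hz : ‖z‖ ≠ 1) {x y : E} (hx : Q x = x) (hy : Q y = y)
    (hx1 : ‖x‖ ≤ 1) (hy1 : ‖y‖ ≤ 1) {s : ℝ} (hs0 : 0 < s) (hs1 : s < 1) :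
    ∫⁻ t, ENNReal.ofReal (‖inner ℂ x (Ring.inverse (phaseMix Q (Complex.exp (Complex.I * t)) * U -
      z • ContinuousLinearMap.id ℂ E) y)‖ ^ s) ∂uniformPhase ≤ ENNReal.ofReal (momentBound s) := by
  have hcos : 0 < Real.cos (Real.pi / 2 * s) :=
    Real.cos_pos_of_mem_Ioo ⟨by nlinarith [Real.pi_pos], by nlinarith [Real.pi_pos]⟩
  have hK : 0 ≤ 16 / Real.cos (Real.pi / 2 * s) := by positivity
  have hM : momentBound s = 2 * (16 / Real.cos (Real.pi / 2 * s)) + 2 := by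
    rw [momentBound]; ring
  have hexp : ∀ t : ℝ, ‖Complex.exp (Complex.I * t)‖ = 1 := Complex.norm_exp_I_mul_ofReal
  have h2s : (2 : ℝ) ^ s ≤ 2 := by
    simpa using Real.rpow_le_rpow_of_exponent_le (x := 2) (by norm_num) hs1.le
  rcases lt_or_gt_of_ne hz with hz1 | hz1
  -- The circle average controls only `z` times the matrix element, which is useless near `z = 0`.
  -- For small `z` the norm bound `1 / (1 - |z|) ≤ 2` suffices; otherwise dividing by `|z| > 1/2`
  -- costs a factor `2`.
  · by_cases hz2 : ‖z‖ ≤ 1 / 2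
    · calc _ ≤ ∫⁻ _, ENNReal.ofReal (momentBound s) ∂uniformPhase := by
            refine lintegral_mono fun t => ENNReal.ofReal_le_ofReal ?_
            have hA := norm_phaseMix_mul_apply hQ hQ2 hU (hexp t)
            have h1 := norm_inverse_sub_smul_id_le hA hz y
            have h2 : ‖y‖ / |1 - ‖z‖| ≤ 2 := by
              rw [abs_of_pos (by linarith), div_le_iff₀ (by linarith)]
              linarith
            calc _ ≤ (2 : ℝ) ^ s := by
                  refine Real.rpow_le_rpow (norm_nonneg _) ?_ hs0.le
                  refine (norm_inner_le_norm _ _).trans ?_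
                  exact (mul_le_mul hx1 (h1.trans h2) (norm_nonneg _) zero_le_one).trans (by simp)
              _ ≤ momentBound s := by linarith
        _ = _ := by simp
    · push Not at hz2
      set f : ℂ → ℝ := fun w => ‖z * inner ℂ x (Ring.inverse (U - z • phaseMix Q w) y)‖ ^ s
      have hfi : CircleIntegrable f 0 1 := circleIntegrable_inner_inverse hQ hQ2 hU hz1 x y hs0
      -- The pencil appears at `w⁻¹`; this is harmless, as circle averages are invariant under
      -- inversion.
      have hfi' : CircleIntegrable (fun w => f w⁻¹) 0 1 := by
        refine ContinuousOn.circleIntegrable' fun w hw => ?_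
        have hw : ‖w‖ = 1 := by simpa using hw
        have hw0 : w ≠ 0 := norm_ne_zero_iff.1 (by rw [hw]; exact one_ne_zero)
        have hcont := continuousAt_inner_inverse hQ hQ2 hU hz1 x y hs0 (w := w⁻¹)
          (by rw [norm_inv, hw, inv_one])
        exact (ContinuousAt.comp (f := fun w : ℂ => w⁻¹) hcont
          (continuousAt_inv₀ hw0)).continuousWithinAt
      calc _ ≤ ∫⁻ t, ENNReal.ofReal 2 *
            ENNReal.ofReal (f (Complex.exp (Complex.I * t))⁻¹) ∂uniformPhase := by
            refine lintegral_mono fun t => ?_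
            rw [← ENNReal.ofReal_mul zero_le_two]
            refine ENNReal.ofReal_le_ofReal ?_
            rw [norm_inner_resolvent_of_norm_lt_one hQ hQ2 hU hz1 x hy (hexp t)]
            set g := ‖inner ℂ x (Ring.inverse
              (U - z • phaseMix Q (Complex.exp (Complex.I * t))⁻¹) y)‖ with hg
            calc g ^ s ≤ (2 * (‖z‖ * g)) ^ s := by
                  refine Real.rpow_le_rpow (norm_nonneg _) ?_ hs0.le
                  nlinarith [norm_nonneg (inner ℂ x (Ring.inverse
                    (U - z • phaseMix Q (Complex.exp (Complex.I * t))⁻¹) y))]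
              _ = 2 ^ s * (‖z‖ * g) ^ s := Real.mul_rpow zero_le_two (by positivity)
              _ ≤ 2 * (‖z‖ * g) ^ s := by gcongr
              _ = _ := by rw [hg, ← norm_mul]
        _ = ENNReal.ofReal 2 * ENNReal.ofReal (Real.circleAverage f 0 1) := by
            rw [lintegral_const_mul' _ _ ENNReal.ofReal_ne_top,
              lintegral_uniformPhase_exp (f := fun w => f w⁻¹) hfi' fun w => by positivity,
              Real.circleAverage_zero_one_congr_inv]
        _ ≤ _ := by
            rw [← ENNReal.ofReal_mul zero_le_two]
            refine ENNReal.ofReal_le_ofReal ?_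
            have := circleAverage_inner_inverse_le hQ hQ2 hU hz1 hx hy hx1 hy1 hs0 hs1
            rw [hM]
            linarith
  · have hUu : IsUnit U := isUnit_of_forall_eq_zero fun u hu => by
      rw [← norm_eq_zero, ← hU, hu, norm_zero]
    set V := Ring.inverse U
    have hUV : U * V = 1 := Ring.mul_inverse_cancel _ hUu
    have hV : ∀ u, ‖V u‖ = ‖u‖ := fun u => by
      rw [← hU (V u)]
      exact congrArg norm (DFunLike.congr_fun hUV u)
    have hζ : ‖z⁻¹‖ < 1 := by
      rw [norm_inv]
      exact inv_lt_one_of_one_lt₀ hz1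
    set f : ℂ → ℝ := fun w => ‖z⁻¹ * inner ℂ x (Ring.inverse (V - z⁻¹ • phaseMix Q w) y)‖ ^ s
    have hfi : CircleIntegrable f 0 1 := circleIntegrable_inner_inverse hQ hQ2 hV hζ x y hs0
    have hfi' : CircleIntegrable (fun w => f w + 1) 0 1 := hfi.add (circleIntegrable_const _ _ _)
    calc _ ≤ ∫⁻ t, ENNReal.ofReal (f (Complex.exp (Complex.I * t)) + 1) ∂uniformPhase := by
          refine lintegral_mono fun t => ENNReal.ofReal_le_ofReal ?_
          refine (Real.rpow_le_rpow (norm_nonneg _) (norm_inner_resolvent_le_of_one_lt_norm hQ hQ2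
            hU hz1 hUV hV hx hx1 hy1 (hexp t)) hs0.le).trans ?_
          refine (rpow_add_le (norm_nonneg _) zero_le_one hs0 hs1).trans ?_
          rw [Real.one_rpow]
      _ = ENNReal.ofReal (Real.circleAverage f 0 1 + 1) := by
          rw [lintegral_uniformPhase_exp (f := fun w => f w + 1) hfi' fun w => by positivity,
            Real.circleAverage_fun_add hfi (circleIntegrable_const _ _ _),
            Real.circleAverage_const]
      _ ≤ _ := by
          refine ENNReal.ofReal_le_ofReal ?_
          have := circleAverage_inner_inverse_le hQ hQ2 hV hζ hx hy hx1 hy1 hs0 hs1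
          rw [hM]
          linarith

end FractionalMoment

/-! ### The walk in coordinates -/

theorem phaseOp_apply (ω : Site → ℝ) (ψ : WalkSpace) (x : Site) :
    phaseOp ω ψ x = Complex.exp (Complex.I * ω x) • ψ x := rfl

theorem coinOp_apply (C : Site → Matrix.unitaryGroup (Fin 3) ℂ) (ψ : WalkSpace) (x : Site)
    (k : Fin 3) : coinOp C ψ x k = ∑ l, (C x : Matrix (Fin 3) (Fin 3) ℂ) k l * ψ x l := rfl

theorem shift_apply (ψ : WalkSpace) (y : Site) (k : Fin 3) :
    shift ψ y k = ψ ((hop k).symm y) k := by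
  have : shift ψ = ∑ l : Fin 3, translate (hop l)
      (lp.mapCLM 2 (fun _ : Site => coinProj l) (norm_nonneg (coinProj l))
        (fun _ => le_rfl) ψ) := by
    simp [shift]
  rw [this, lp.coeFn_sum, Finset.sum_apply]
  simp [translate_apply, coinProj_apply, Pi.single_apply]

theorem walk_apply (C : Site → Matrix.unitaryGroup (Fin 3) ℂ) (ω : Site → ℝ) (ψ : WalkSpace)
    (y : Site) (k : Fin 3) : walk C ω ψ y k = Complex.exp (Complex.I * ω y) *
      ∑ l, (C ((hop k).symm y) : Matrix (Fin 3) (Fin 3) ℂ) k l * ψ ((hop k).symm y) l := by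
  have h : walk C ω ψ y k =
      Complex.exp (Complex.I * ω y) * shift (coinOp C ψ) y k := rfl
  rw [h, shift_apply, coinOp_apply]

theorem norm_sq_eq_tsum (ψ : WalkSpace) : ‖ψ‖ ^ 2 = ∑' x, ‖ψ x‖ ^ 2 := by
  have h := lp.norm_rpow_eq_tsum (p := 2) (by norm_num) ψ
  simpa using h

theorem summable_norm_sq (ψ : WalkSpace) : Summable fun x => ‖ψ x‖ ^ 2 := by
  have h := (lp.memℓp ψ).summable (p := 2) (by norm_num)
  simpa using h

theorem summable_norm_sq_coord (ψ : WalkSpace) (k : Fin 3) : Summable fun x => ‖ψ x k‖ ^ 2 := by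
  refine (summable_norm_sq ψ).of_nonneg_of_le (fun x => by positivity) fun x => ?_
  gcongr
  exact PiLp.norm_apply_le (ψ x) k

theorem norm_sq_eq_sum_tsum (ψ : WalkSpace) : ‖ψ‖ ^ 2 = ∑ k : Fin 3, ∑' x, ‖ψ x k‖ ^ 2 := by
  rw [norm_sq_eq_tsum, ← Summable.tsum_finsetSum fun k _ => summable_norm_sq_coord ψ k]
  exact tsum_congr fun x => EuclideanSpace.norm_sq_eq (ψ x)

theorem norm_le_mul_of_forall {φ ψ : WalkSpace} {c : ℝ} (hc : 0 ≤ c)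
    (h : ∀ x, ‖φ x‖ ≤ c * ‖ψ x‖) : ‖φ‖ ≤ c * ‖ψ‖ := by
  have h1 : ‖φ‖ ≤ ‖(c : ℂ) • ψ‖ := by
    refine lp.norm_mono (by simp) fun x => ?_
    rw [lp.coeFn_smul, Pi.smul_apply, norm_smul]
    simpa [abs_of_nonneg hc] using h x
  rw [norm_smul] at h1
  simpa [abs_of_nonneg hc] using h1

theorem norm_eq_of_forall {φ ψ : WalkSpace} (h : ∀ x, ‖φ x‖ = ‖ψ x‖) : ‖φ‖ = ‖ψ‖ :=
  le_antisymm (lp.norm_mono (by simp) fun x => (h x).le)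
    (lp.norm_mono (by simp) fun x => (h x).ge)

theorem norm_coord_le (ψ : WalkSpace) (x : Site) (k : Fin 3) : ‖ψ x k‖ ≤ ‖ψ‖ :=
  (PiLp.norm_apply_le (ψ x) k).trans (lp.norm_apply_le_norm (by simp) ψ x)

theorem norm_ket (x : Site) (i : Fin 3) : ‖ket x i‖ = 1 := by
  classical
  rw [ket, lp.norm_single (by norm_num)]
  simp

theorem norm_phaseOp_apply (ω : Site → ℝ) (ψ : WalkSpace) : ‖phaseOp ω ψ‖ = ‖ψ‖ :=
  norm_eq_of_forall fun x => by
    rw [phaseOp_apply, norm_smul, Complex.norm_exp_I_mul_ofReal, one_mul]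

theorem norm_shift_apply (ψ : WalkSpace) : ‖shift ψ‖ = ‖ψ‖ := by
  rw [← sq_eq_sq₀ (norm_nonneg _) (norm_nonneg _), norm_sq_eq_sum_tsum, norm_sq_eq_sum_tsum]
  refine Finset.sum_congr rfl fun k _ => ?_
  simp only [shift_apply]
  exact (hop k).symm.tsum_eq fun x => ‖ψ x k‖ ^ 2

theorem norm_coinOp_apply (C : Site → Matrix.unitaryGroup (Fin 3) ℂ) (ψ : WalkSpace) :
    ‖coinOp C ψ‖ = ‖ψ‖ :=
  norm_eq_of_forall fun x => ContinuousLinearMap.norm_map_of_mem_unitary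
    (Unitary.map_mem (Matrix.toEuclideanCLM (n := Fin 3) (𝕜 := ℂ)) (C x).2) (ψ x)

theorem norm_walk_apply (C : Site → Matrix.unitaryGroup (Fin 3) ℂ) (ω : Site → ℝ)
    (ψ : WalkSpace) : ‖walk C ω ψ‖ = ‖ψ‖ := by
  change ‖phaseOp ω (shift (coinOp C ψ))‖ = _
  rw [norm_phaseOp_apply, norm_shift_apply, norm_coinOp_apply]

/-- Coin matrices that are entrywise close give walks that are close in norm. -/
theorem norm_walk_sub_walk_le {C C' : Site → Matrix.unitaryGroup (Fin 3) ℂ} {δ : ℝ} (hδ : 0 ≤ δ)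
    (h : ∀ x k l, ‖(C x : Matrix (Fin 3) (Fin 3) ℂ) k l -
      (C' x : Matrix (Fin 3) (Fin 3) ℂ) k l‖ ≤ δ) (ω : Site → ℝ) (ψ : WalkSpace) :
    ‖walk C ω ψ - walk C' ω ψ‖ ≤ 3 * δ * ‖ψ‖ := by
  have h1 : walk C ω ψ - walk C' ω ψ = phaseOp ω (shift (coinOp C ψ - coinOp C' ψ)) := by
    rw [map_sub, map_sub]
    rfl
  rw [h1, norm_phaseOp_apply, norm_shift_apply]
  refine norm_le_mul_of_forall (by positivity) fun x => ?_
  rw [← sq_le_sq₀ (by positivity) (by positivity), EuclideanSpace.norm_sq_eq, mul_pow,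
    EuclideanSpace.norm_sq_eq (ψ x)]
  have h2 : ∀ k, ‖(coinOp C ψ - coinOp C' ψ) x k‖ ≤
      δ * (‖ψ x 0‖ + ‖ψ x 1‖ + ‖ψ x 2‖) := fun k => by
    have h3 : (coinOp C ψ - coinOp C' ψ) x k = ∑ l, ((C x : Matrix (Fin 3) (Fin 3) ℂ) k l -
        (C' x : Matrix (Fin 3) (Fin 3) ℂ) k l) * ψ x l := by
      simp only [sub_mul, Finset.sum_sub_distrib, ← coinOp_apply]
      rfl
    rw [h3, mul_add, mul_add]
    refine (norm_sum_le _ _).trans ?_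
    rw [Fin.sum_univ_three, norm_mul, norm_mul, norm_mul]
    gcongr <;> exact h _ _ _
  rw [Fin.sum_univ_three, Fin.sum_univ_three]
  have h4 : ∀ k, ‖(coinOp C ψ - coinOp C' ψ) x k‖ ^ 2 ≤
      δ ^ 2 * (3 * (‖ψ x 0‖ ^ 2 + ‖ψ x 1‖ ^ 2 + ‖ψ x 2‖ ^ 2)) := fun k => by
    refine (pow_le_pow_left₀ (norm_nonneg _) (h2 k) 2).trans ?_
    rw [mul_pow]
    gcongr
    nlinarith [sq_nonneg (‖ψ x 0‖ - ‖ψ x 1‖), sq_nonneg (‖ψ x 0‖ - ‖ψ x 2‖),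
      sq_nonneg (‖ψ x 1‖ - ‖ψ x 2‖)]
  linarith [h4 0, h4 1, h4 2]

/-! ### The localised walk -/

/-- The walk with coin `C₀` on all sites. -/
noncomputable def walkZero (ω : Site → ℝ) : WalkSpace →L[ℂ] WalkSpace :=
  walk (fun _ => coinZero) ω

/-- Since `C₀` sends `e_{k+1}` to `e_k` cyclically, each output coordinate comes from a single input
coordinate. -/
theorem walkZero_apply (ω : Site → ℝ) (ψ : WalkSpace) (y : Site) (k : Fin 3) :
    walkZero ω ψ y k = Complex.exp (Complex.I * ω y) * ψ ((hop k).symm y) (k + 1) := by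
  rw [walkZero, walk_apply]
  fin_cases k <;> simp [coinZero, Fin.sum_univ_three]

/-- The label of the cell that contains a given basis vector. -/
def cellLabel : Site → Fin 3 → ℤ × ℤ
  | (n, .A), _ => n
  | (n, .B), k => n + stepB (k + 2)

/-- This is the invariance of cells under the `C₀` walk: the predecessor of a basis vector lies in
the same cell. -/
theorem cellLabel_hop_symm (y : Site) (k : Fin 3) :
    cellLabel ((hop k).symm y) (k + 1) = cellLabel y k := by
  obtain ⟨⟨a, b⟩, _ | _⟩ := y <;> fin_cases k <;>
    simp [hop, cellLabel, stepA, stepB, sub_eq_add_neg]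

theorem mem_cellLabels_iff {x : Site} {k : Fin 3} {n : ℤ × ℤ} :
    (x, k) ∈ cellLabels n ↔ cellLabel x k = n := by
  obtain ⟨⟨a, b⟩, _ | _⟩ := x <;> obtain ⟨c, d⟩ := n <;> fin_cases k <;>
    simp [cellLabels, cellLabel, stepB, Prod.ext_iff] <;> omega

/-- The functions supported on the cells with label in `B`. -/
def supportedIn (B : Set (ℤ × ℤ)) : Submodule ℂ WalkSpace where
  carrier := {ψ | ∀ x k, cellLabel x k ∉ B → ψ x k = 0}
  zero_mem' := fun _ _ _ => rfl
  add_mem' := fun {φ ψ} hφ hψ x k h => by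
    change φ x k + ψ x k = 0
    rw [hφ x k h, hψ x k h, add_zero]
  smul_mem' := fun c ψ hψ x k h => by
    change c * ψ x k = 0
    rw [hψ x k h, mul_zero]

theorem ket_mem_supportedIn {B : Set (ℤ × ℤ)} {x : Site} {i : Fin 3} (h : cellLabel x i ∈ B) :
    ket x i ∈ supportedIn B := by
  classical
  intro y k hy
  rw [ket_apply]
  split_ifs with h1 h2
  · subst h1 h2
    exact absurd h hy
  · rfl
  · rfl

theorem boxSpace_le_supportedIn (L : ℕ × ℕ) (v : ℤ × ℤ) :
    boxSpace L v ≤ supportedIn {n | n - v ∈ boxCells L} := by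
  refine iSup₂_le fun n hn => Submodule.span_le.2 ?_
  rintro _ ⟨⟨x, i⟩, hb, rfl⟩
  refine ket_mem_supportedIn ?_
  rw [mem_cellLabels_iff.1 hb]
  simpa using hn

theorem cellLabel_mem_of_ket_mem_boxSpace {L : ℕ × ℕ} {v : ℤ × ℤ} {x : Site} {i : Fin 3}
    (h : ket x i ∈ boxSpace L v) : cellLabel x i - v ∈ boxCells L := by
  classical
  by_contra hn
  have := boxSpace_le_supportedIn L v h x i hn
  rw [ket_apply] at this
  simp at this

theorem cellLabel_ne_of_not_equivalent {x y : Site} {i j : Fin 3} (h : ¬ Equivalent x i y j) :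
    cellLabel x i ≠ cellLabel y j := fun he => by
  refine h ⟨cellLabel y j, Submodule.subset_span ⟨(x, i), ?_, rfl⟩,
    Submodule.subset_span ⟨(y, j), ?_, rfl⟩⟩
  · exact mem_cellLabels_iff.2 he
  · exact mem_cellLabels_iff.2 rfl

theorem walkZero_mem_supportedIn {B : Set (ℤ × ℤ)} (ω : Site → ℝ) {ψ : WalkSpace}
    (h : ψ ∈ supportedIn B) : walkZero ω ψ ∈ supportedIn B := fun x k hx => by
  rw [walkZero_apply, h _ _ (by rwa [cellLabel_hop_symm]), mul_zero]

/-- The total phase picked up on a round trip through a cell. -/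
noncomputable def cellAngle (ω : Site → ℝ) (n : ℤ × ℤ) : ℝ :=
  3 * ω (n, .A) + ∑ k, ω (n - stepB k, .B)

/-- Reason for localisation: the hop with index `k` out of a `B` site undoes the hop with index `k +
1` that led there, so the walker keeps returning to the same `A` site. -/
theorem stepA_add_one (k : Fin 3) : stepA (k + 1) = -stepB k := by
  fin_cases k <;> simp [stepA, stepB]

theorem walkZero_walkZero_apply_A (ω : Site → ℝ) (ψ : WalkSpace) (n : ℤ × ℤ) (k : Fin 3) :
    walkZero ω (walkZero ω ψ) (n, .A) k =
      Complex.exp (Complex.I * (ω (n, .A) + ω (n - stepB k, .B))) * ψ (n, .A) (k + 2) := by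
  have h1 : (hop k).symm (n, .A) = (n - stepB k, .B) := rfl
  have h2 : (hop (k + 1)).symm (n - stepB k, .B) = (n, .A) := by
    change (n - stepB k - stepA (k + 1), Sublattice.A) = _
    rw [stepA_add_one, sub_neg_eq_add, sub_add_cancel]
  rw [walkZero_apply, walkZero_apply, h1, h2, ← mul_assoc, ← Complex.exp_add, mul_add, add_assoc]
  rfl

theorem walkZero_walkZero_apply_B (ω : Site → ℝ) (ψ : WalkSpace) (n : ℤ × ℤ) (k : Fin 3) :
    walkZero ω (walkZero ω ψ) (n - stepB k, .B) (k + 1) =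
      Complex.exp (Complex.I * (ω (n, .A) + ω (n - stepB k, .B))) *
        ψ (n - stepB (k + 2), .B) (k + 2 + 1) := by
  have h1 : (hop (k + 1)).symm (n - stepB k, .B) = (n, .A) := by
    change (n - stepB k - stepA (k + 1), Sublattice.A) = _
    rw [stepA_add_one, sub_neg_eq_add, sub_add_cancel]
  have h2 : (hop (k + 1 + 1)).symm (n, .A) = (n - stepB (k + 2), .B) := by
    rw [add_assoc]
    rfl
  rw [walkZero_apply, walkZero_apply, h1, h2, ← mul_assoc, ← Complex.exp_add, ← mul_add,
    add_comm (ω (n - stepB k, .B) : ℂ), show k + 1 + 1 + 1 = k + 2 + 1 by rw [add_assoc k]; rfl]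

theorem cellAngle_eq (ω : Site → ℝ) (n : ℤ × ℤ) (k : Fin 3) :
    (cellAngle ω n : ℂ) = (ω (n, .A) + ω (n - stepB k, .B)) +
      ((ω (n, .A) + ω (n - stepB (k + 2), .B)) + (ω (n, .A) + ω (n - stepB (k + 2 + 2), .B))) := by
  have h : ∀ f : Fin 3 → ℂ, ∑ j, f j = f k + (f (k + 2) + f (k + 2 + 2)) := fun f => by
    rw [Fin.sum_univ_three]
    fin_cases k
    · change f 0 + f 1 + f 2 = f 0 + (f 2 + f 1)
      ring
    · change f 0 + f 1 + f 2 = f 1 + (f 0 + f 2)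
      ring
    · change f 0 + f 1 + f 2 = f 2 + (f 1 + f 0)
      ring
  rw [cellAngle]
  push_cast
  rw [h]
  ring

/-- Two steps return to the same sublattice and rotate the coin index by `2`, so three double steps
close the orbit. The round trip visits the `A` site three times and each of its `B` sites once,
which produces `cellAngle`. -/
theorem walkZero_pow_six_apply (ω : Site → ℝ) (ψ : WalkSpace) (y : Site) (k : Fin 3) :
    (walkZero ω ^ 6) ψ y k =
      Complex.exp (Complex.I * cellAngle ω (cellLabel y k)) * ψ y k := by
  have h : (walkZero ω ^ 6) ψ = walkZero ω (walkZero ω (walkZero ω (walkZero ω (walkZero ω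
      (walkZero ω ψ))))) := by
    simp only [pow_succ, pow_zero, one_mul, mul_apply_eq_comp]
  have h6 : ∀ j : Fin 3, j + 2 + 2 + 2 = j := fun j => by
    rw [add_assoc, add_assoc, show (2 : Fin 3) + (2 + 2) = 0 from rfl, add_zero]
  rw [h]
  obtain ⟨n, _ | _⟩ := y
  · rw [walkZero_walkZero_apply_A, walkZero_walkZero_apply_A, walkZero_walkZero_apply_A, h6,
      cellLabel, cellAngle_eq ω n k, mul_add _ _ (_ + _), mul_add _ (_ + _) (_ + _),
      Complex.exp_add, Complex.exp_add, mul_assoc, mul_assoc]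
  · obtain ⟨j, rfl⟩ : ∃ j, k = j + 1 := ⟨k + 2, by
      rw [add_assoc, show (2 : Fin 3) + 1 = 0 from rfl, add_zero]⟩
    obtain ⟨m, rfl⟩ : ∃ m, n = m - stepB j := ⟨n + stepB j, (add_sub_cancel_right _ _).symm⟩
    have hl : cellLabel (m - stepB j, .B) (j + 1) = m := by
      rw [cellLabel, add_assoc, show (1 : Fin 3) + 2 = 0 from rfl, add_zero, sub_add_cancel]
    rw [walkZero_walkZero_apply_B, walkZero_walkZero_apply_B, walkZero_walkZero_apply_B, h6, hl,
      cellAngle_eq ω m j, mul_add _ _ (_ + _), mul_add _ (_ + _) (_ + _),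
      Complex.exp_add, Complex.exp_add, mul_assoc, mul_assoc]

/-! ### Resolvent bounds away from resonances -/

/-- The quotient of `U₀⁶ - z⁶` by `U₀ - z`. -/
noncomputable def geomWalk (ω : Site → ℝ) (z : ℂ) : WalkSpace →L[ℂ] WalkSpace :=
  ∑ i ∈ Finset.range 6, z ^ (5 - i) • walkZero ω ^ i

theorem norm_walkZero_pow_apply (ω : Site → ℝ) (i : ℕ) (ψ : WalkSpace) :
    ‖(walkZero ω ^ i) ψ‖ = ‖ψ‖ := by
  induction i with
  | zero => rfl
  | succ i ih =>
    rw [pow_succ', mul_apply_eq_comp, ← ih]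
    exact norm_walk_apply _ _ _

theorem norm_geomWalk_apply_le (ω : Site → ℝ) (z : ℂ) (ψ : WalkSpace) :
    ‖geomWalk ω z ψ‖ ≤ 6 * max 1 ‖z‖ ^ 5 * ‖ψ‖ := by
  rw [geomWalk, sum_apply]
  refine (norm_sum_le _ _).trans ?_
  calc _ ≤ ∑ i ∈ Finset.range 6, max 1 ‖z‖ ^ 5 * ‖ψ‖ := by
        refine Finset.sum_le_sum fun i _ => ?_
        rw [smul_apply, norm_smul, norm_walkZero_pow_apply, norm_pow]
        gcongr
        calc ‖z‖ ^ (5 - i) ≤ max 1 ‖z‖ ^ (5 - i) := by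
              gcongr
              exact le_max_right _ _
          _ ≤ max 1 ‖z‖ ^ 5 := pow_le_pow_right₀ (le_max_left _ _) (Nat.sub_le _ _)
    _ = _ := by
        rw [Finset.sum_const, Finset.card_range, nsmul_eq_mul]
        push_cast
        ring

theorem geomWalk_mem_supportedIn {B : Set (ℤ × ℤ)} (ω : Site → ℝ) (z : ℂ) {ψ : WalkSpace}
    (h : ψ ∈ supportedIn B) : geomWalk ω z ψ ∈ supportedIn B := by
  have hpow : ∀ i : ℕ, (walkZero ω ^ i) ψ ∈ supportedIn B := fun i => by
    induction i with
    | zero => exact h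
    | succ i ih =>
      rw [pow_succ', mul_apply_eq_comp]
      exact walkZero_mem_supportedIn ω ih
  rw [geomWalk, sum_apply]
  exact Submodule.sum_mem _ fun i _ => Submodule.smul_mem _ _ (hpow i)

theorem sum_smul_pow_apply_sub {E : Type*} [NormedAddCommGroup E] [NormedSpace ℂ E]
    (W : E →L[ℂ] E) (z : ℂ) (ψ : E) :
    (∑ i ∈ Finset.range 6, z ^ (5 - i) • W ^ i) (W ψ - z • ψ) = (W ^ 6) ψ - z ^ 6 • ψ := by
  have h1 : ∀ i, (W ^ i) (W ψ) = (W ^ (i + 1)) ψ := fun i => by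
    rw [pow_succ, mul_apply_eq_comp]
  simp only [Finset.sum_range_succ, Finset.sum_range_zero, zero_add, map_sub, map_smul, add_apply,
    smul_apply, h1]
  simp only [pow_zero, one_apply_eq_self, Nat.sub_self, Nat.reduceSub, Nat.reduceAdd]
  module

theorem geomWalk_apply_sub (ω : Site → ℝ) (z : ℂ) (ψ : WalkSpace) (x : Site) (k : Fin 3) :
    geomWalk ω z (walkZero ω ψ - z • ψ) x k =
      (Complex.exp (Complex.I * cellAngle ω (cellLabel x k)) - z ^ 6) * ψ x k := by
  rw [geomWalk, sum_smul_pow_apply_sub, sub_mul, ← walkZero_pow_six_apply]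
  generalize (walkZero ω ^ 6) ψ = φ
  rfl

/-- If `e^{iθ}` stays away from `z⁶` for all cells under consideration, then the resolvent of the
localised walk is bounded. -/
theorem mul_norm_le_of_supportedIn {B : Set (ℤ × ℤ)} {ω : Site → ℝ} {z : ℂ} {η : ℝ} (hη : 0 ≤ η)
    (hB : ∀ n ∈ B, 6 * max 1 ‖z‖ ^ 5 * η ≤ ‖Complex.exp (Complex.I * cellAngle ω n) - z ^ 6‖)
    {ψ : WalkSpace} (hψ : ψ ∈ supportedIn B) : η * ‖ψ‖ ≤ ‖walkZero ω ψ - z • ψ‖ := by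
  set τ := 6 * max 1 ‖z‖ ^ 5 with hτ
  have hτ0 : 0 < τ := by positivity
  -- After applying the quotient `G`, the operator is diagonal, so the lower bound can be checked
  -- coordinate by coordinate; `‖G‖ ≤ τ` then returns it to `U₀ - z`.
  have h1 : τ * η * ‖ψ‖ ≤ ‖geomWalk ω z (walkZero ω ψ - z • ψ)‖ := by
    have h2 : ‖((τ * η : ℝ) : ℂ) • ψ‖ ≤ ‖geomWalk ω z (walkZero ω ψ - z • ψ)‖ := by
      refine lp.norm_mono (by simp) fun x => ?_
      rw [← sq_le_sq₀ (norm_nonneg _) (norm_nonneg _), EuclideanSpace.norm_sq_eq,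
        EuclideanSpace.norm_sq_eq]
      refine Finset.sum_le_sum fun k _ => ?_
      gcongr
      rw [geomWalk_apply_sub, norm_mul]
      change ‖((τ * η : ℝ) : ℂ) * ψ x k‖ ≤ _
      rw [norm_mul, Complex.norm_of_nonneg (by positivity)]
      by_cases hx : cellLabel x k ∈ B
      · gcongr
        exact hB _ hx
      · rw [hψ x k hx]
        simp
    rwa [norm_smul, Complex.norm_of_nonneg (by positivity)] at h2
  have h3 := norm_geomWalk_apply_le ω z (walkZero ω ψ - z • ψ)
  refine le_of_mul_le_mul_left ?_ hτ0
  rw [← mul_assoc]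
  exact h1.trans h3

/-- Decay of the off-diagonal resolvent entries away from resonances, by perturbation theory
around the localised walk. -/
theorem norm_resolvent_coord_le {B : Set (ℤ × ℤ)} {ω : Site → ℝ} {z : ℂ} {η δ : ℝ} (hη : 0 < η)
    (hB : ∀ n ∈ B, 6 * max 1 ‖z‖ ^ 5 * η ≤ ‖Complex.exp (Complex.I * cellAngle ω n) - z ^ 6‖)
    {C : Site → Matrix.unitaryGroup (Fin 3) ℂ} (hδ : 0 ≤ δ) (hδη : 6 * δ ≤ η)
    (hC : ∀ x k l, ‖(C x : Matrix (Fin 3) (Fin 3) ℂ) k l -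
      (coinZero : Matrix (Fin 3) (Fin 3) ℂ) k l‖ ≤ δ) {x y : Site} {i j : Fin 3}
    (hx : cellLabel x i ∈ B) (hxy : cellLabel x i ≠ cellLabel y j) {ψ : WalkSpace}
    (hψ : ψ ∈ supportedIn B) (h : walk C ω ψ - z • ψ = ket y j) : ‖ψ x i‖ ≤ 6 * δ / η ^ 2 := by
  set τ := 6 * max 1 ‖z‖ ^ 5 with hτ
  have hτ0 : 0 < τ := by positivity
  set χ := walk C ω ψ - walkZero ω ψ with hχ
  have hχ1 : ‖χ‖ ≤ 3 * δ * ‖ψ‖ := norm_walk_sub_walk_le hδ hC ω ψ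
  have h1 : walkZero ω ψ - z • ψ = ket y j - χ := by
    rw [← h, hχ]
    abel
  -- The error `3δ‖ψ‖` is at most `η‖ψ‖/2` and is absorbed into the left side of `η‖ψ‖ ≤ 1 + 3δ‖ψ‖`.
  have h2 : ‖ψ‖ ≤ 2 / η := by
    have h3 := mul_norm_le_of_supportedIn hη.le hB hψ
    rw [h1] at h3
    have h4 := norm_sub_le (ket y j) χ
    rw [norm_ket] at h4
    rw [le_div_iff₀ hη]
    nlinarith [norm_nonneg ψ]
  have h5 : τ * η * ‖ψ x i‖ ≤ τ * (3 * δ * (2 / η)) := by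
    calc τ * η * ‖ψ x i‖ ≤
          ‖Complex.exp (Complex.I * cellAngle ω (cellLabel x i)) - z ^ 6‖ * ‖ψ x i‖ := by
          gcongr
          exact hB _ hx
      _ = ‖geomWalk ω z χ x i‖ := by
          -- The unperturbed term stays in the cell of `y⁽ʲ⁾` and is invisible at `x⁽ⁱ⁾`; only the
          -- perturbation `χ` contributes.
          have h6 : geomWalk ω z (ket y j) x i = 0 :=
            geomWalk_mem_supportedIn ω z
              (ket_mem_supportedIn (B := {cellLabel y j}) rfl) x i hxy
          rw [← norm_mul, ← geomWalk_apply_sub, h1, map_sub]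
          change ‖geomWalk ω z (ket y j) x i - geomWalk ω z χ x i‖ = _
          rw [h6, zero_sub, norm_neg]
      _ ≤ ‖geomWalk ω z χ‖ := norm_coord_le _ _ _
      _ ≤ τ * ‖χ‖ := norm_geomWalk_apply_le ω z χ
      _ ≤ τ * (3 * δ * (2 / η)) := by
          gcongr
          exact hχ1.trans (by gcongr)
  rw [mul_assoc] at h5
  have h7 := le_of_mul_le_mul_left h5 hτ0
  rw [le_div_iff₀ (by positivity)]
  calc ‖ψ x i‖ * η ^ 2 = η * ‖ψ x i‖ * η := by ring
    _ ≤ 3 * δ * (2 / η) * η := by gcongr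
    _ = 6 * δ := by field_simp; ring

/-! ### The walk on the box -/

theorem finite_boxCells (L : ℕ × ℕ) : (boxCells L).Finite :=
  ((Set.finite_Icc (-(L.1 : ℤ)) (L.1 - 1)).prod (Set.finite_Icc (-(L.2 : ℤ)) (L.2 - 1))).subset
    fun _ h => ⟨⟨h.1, h.2.1⟩, h.2.2.1, h.2.2.2.1⟩

theorem finite_cellLabels (n : ℤ × ℤ) : (cellLabels n).Finite := by
  unfold cellLabels
  exact Set.toFinite _

/-- Finite dimension makes injectivity of `U - z` enough for invertibility. -/
instance (L : ℕ × ℕ) (v : ℤ × ℤ) : FiniteDimensional ℂ (boxSpace L v) := by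
  have hfin : Finite (boxCells L) := finite_boxCells L
  have hcell : ∀ n, FiniteDimensional ℂ (cell n) := fun n =>
    FiniteDimensional.span_of_finite ℂ ((finite_cellLabels n).image _)
  rw [boxSpace, iSup_subtype']
  infer_instance

/-- A subspace containing all basis vectors of the box contains the subspace of the box. -/
theorem boxSpace_le {L : ℕ × ℕ} {v : ℤ × ℤ} {W : Submodule ℂ WalkSpace}
    (h : ∀ x i, ket x i ∈ boxSpace L v → ket x i ∈ W) : boxSpace L v ≤ W := by
  refine iSup₂_le fun n hn => Submodule.span_le.2 ?_
  rintro _ ⟨⟨x, i⟩, hb, rfl⟩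
  exact h x i (ket_mem_boxSpace (n := n + v) (by simpa using hn) hb)

open scoped Classical in
/-- The projection onto the span of the vectors located at the sites in `S`. -/
noncomputable def siteProj (S : Set Site) : WalkSpace →L[ℂ] WalkSpace :=
  lp.mapCLM 2 (fun x => if x ∈ S then ContinuousLinearMap.id ℂ Coin else 0) zero_le_one
    (fun x => by split_ifs <;> simp)

open scoped Classical in
theorem siteProj_apply (S : Set Site) (ψ : WalkSpace) (x : Site) :
    siteProj S ψ x = if x ∈ S then ψ x else 0 := by
  have h : siteProj S ψ x =
    (if x ∈ S then ContinuousLinearMap.id ℂ Coin else 0 : Coin →L[ℂ] Coin) (ψ x) := rfl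
  rw [h]
  split_ifs <;> rfl

theorem siteProj_ket_of_mem {S : Set Site} {x : Site} (hx : x ∈ S) (i : Fin 3) :
    siteProj S (ket x i) = ket x i := by
  classical
  ext y k
  rw [siteProj_apply]
  split_ifs with hy
  · rfl
  · have : y ≠ x := fun h => hy (h ▸ hx)
    simp [ket_apply, this]

theorem siteProj_ket_of_notMem {S : Set Site} {x : Site} (hx : x ∉ S) (i : Fin 3) :
    siteProj S (ket x i) = 0 := by
  classical
  ext y k
  rw [siteProj_apply]
  split_ifs with hy
  · have : y ≠ x := fun h => hx (h ▸ hy)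
    simp [ket_apply, this]
  · rfl

theorem inner_siteProj_left (S : Set Site) (φ ψ : WalkSpace) :
    inner ℂ (siteProj S φ) ψ = inner ℂ φ (siteProj S ψ) := by
  classical
  rw [lp.inner_eq_tsum, lp.inner_eq_tsum]
  refine tsum_congr fun x => ?_
  rw [siteProj_apply, siteProj_apply]
  split_ifs <;> simp

theorem siteProj_siteProj (S : Set Site) (ψ : WalkSpace) :
    siteProj S (siteProj S ψ) = siteProj S ψ := by
  classical
  ext x k
  simp only [siteProj_apply]
  split_ifs <;> rfl

theorem boxSpace_invariant_siteProj (L : ℕ × ℕ) (v : ℤ × ℤ) (S : Set Site) :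
    ∀ ψ ∈ boxSpace L v, siteProj S ψ ∈ boxSpace L v := by
  suffices h : boxSpace L v ≤ (boxSpace L v).comap (siteProj S).toLinearMap from fun ψ hψ => h hψ
  refine boxSpace_le fun x i hx => ?_
  change siteProj S (ket x i) ∈ boxSpace L v
  by_cases hS : x ∈ S
  · rwa [siteProj_ket_of_mem hS]
  · rw [siteProj_ket_of_notMem hS]
    exact Submodule.zero_mem _

/-- The restriction of `siteProj S` to the subspace of the box. -/
noncomputable def boxProj (L : ℕ × ℕ) (v : ℤ × ℤ) (S : Set Site) :
    boxSpace L v →L[ℂ] boxSpace L v :=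
  (siteProj S).restrict (boxSpace_invariant_siteProj L v S)

variable {L : ℕ × ℕ} {v : ℤ × ℤ}

theorem coe_boxWalk (C : Matrix.unitaryGroup (Fin 3) ℂ) (ω : Site → ℝ) (ψ : boxSpace L v) :
    (boxWalk L v C ω ψ : WalkSpace) = walk (boxCoin L v C) ω ψ := rfl

theorem isSymmetric_boxProj (S : Set Site) :
    (boxProj L v S : boxSpace L v →ₗ[ℂ] boxSpace L v).IsSymmetric := fun φ ψ =>
  inner_siteProj_left S (φ : WalkSpace) (ψ : WalkSpace)

theorem boxProj_mul_self (S : Set Site) : boxProj L v S * boxProj L v S = boxProj L v S := by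
  refine ContinuousLinearMap.ext fun ψ => Subtype.ext ?_
  exact siteProj_siteProj S ψ

theorem norm_boxWalk_apply (C : Matrix.unitaryGroup (Fin 3) ℂ) (ω : Site → ℝ)
    (ψ : boxSpace L v) : ‖boxWalk L v C ω ψ‖ = ‖ψ‖ :=
  norm_walk_apply (boxCoin L v C) ω (ψ : WalkSpace)

theorem walk_add_indicator (C : Site → Matrix.unitaryGroup (Fin 3) ℂ) (ω : Site → ℝ)
    (S : Set Site) (t : ℝ) (ψ : WalkSpace) :
    walk C (ω + S.indicator fun _ => t) ψ = walk C ω ψ - siteProj S (walk C ω ψ) +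
      Complex.exp (Complex.I * t) • siteProj S (walk C ω ψ) := by
  classical
  ext x k
  have h : ∀ ω' : Site → ℝ, walk C ω' ψ x =
      Complex.exp (Complex.I * ω' x) • shift (coinOp C ψ) x := fun _ => rfl
  simp only [lp.coeFn_add, lp.coeFn_sub, lp.coeFn_smul, Pi.add_apply, Pi.sub_apply, Pi.smul_apply,
    siteProj_apply]
  rw [h, h]
  by_cases hx : x ∈ S
  · simp only [Pi.add_apply, Set.indicator_of_mem hx, if_true, sub_self, smul_smul, hx,
      ← Complex.exp_add, Complex.ofReal_add, mul_add, add_comm]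
    rw [add_zero]
  · simp [hx]

/-- A common phase shift at the sites of `S` multiplies the walk by a phase on the range of the
projection `boxProj L v S`. -/
theorem boxWalk_add_indicator (C : Matrix.unitaryGroup (Fin 3) ℂ) (ω : Site → ℝ)
    (S : Set Site) (t : ℝ) : boxWalk L v C (ω + S.indicator fun _ => t) =
      phaseMix (boxProj L v S) (Complex.exp (Complex.I * t)) * boxWalk L v C ω := by
  refine ContinuousLinearMap.ext fun ψ => Subtype.ext ?_
  exact walk_add_indicator _ ω S t ψ

theorem dependsOnPhase_boxWalk (C : Matrix.unitaryGroup (Fin 3) ℂ) :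
    DependsOnPhase (boxWalk L v C) := fun ω ω' h => by
  refine ContinuousLinearMap.ext fun ψ => Subtype.ext ?_
  rw [coe_boxWalk, coe_boxWalk]
  ext x k
  rw [walk_apply, walk_apply, h]

theorem continuous_walk_apply (C : Site → Matrix.unitaryGroup (Fin 3) ℂ) {ψ : WalkSpace}
    (hψ : ψ ∈ boxSpace L v) : Continuous fun ω : Site → ℝ => walk C ω ψ := by
  -- The vectors with continuous orbit map form a subspace, so only basis vectors need checking; for
  -- these just three phases enter.
  let W : Submodule ℂ WalkSpace :=
    { carrier := {ψ | Continuous fun ω : Site → ℝ => walk C ω ψ}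
      zero_mem' := by
        change Continuous fun ω : Site → ℝ => walk C ω 0
        simp only [map_zero]
        exact continuous_const
      add_mem' := fun {φ ψ} hφ hψ => by
        change Continuous fun ω : Site → ℝ => walk C ω (φ + ψ)
        simp only [map_add]
        exact Continuous.add hφ hψ
      smul_mem' := fun c ψ hψ => by
        change Continuous fun ω : Site → ℝ => walk C ω (c • ψ)
        simp only [map_smul]
        exact Continuous.const_smul hψ c }
  refine boxSpace_le (W := W) (fun x i _ => ?_) hψ
  change Continuous fun ω : Site → ℝ => walk C ω (ket x i)
  simp only [walk_ket]
  fun_prop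

theorem continuous_boxWalk (C : Matrix.unitaryGroup (Fin 3) ℂ) :
    Continuous (boxWalk L v C) := by
  rw [continuous_clm_apply]
  exact fun ψ => (continuous_walk_apply (boxCoin L v C) ψ.2).subtype_mk _

variable {z : ℂ}

theorem isUnit_boxWalk_sub (C : Matrix.unitaryGroup (Fin 3) ℂ) (ω : Site → ℝ) (hz : ‖z‖ ≠ 1) :
    IsUnit (boxWalk L v C ω - z • ContinuousLinearMap.id ℂ (boxSpace L v)) :=
  isUnit_sub_smul_id (norm_boxWalk_apply C ω) hz

/-- The modulus of a matrix element of the resolvent of the boxed walk. -/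
noncomputable def greenAbs (C : Matrix.unitaryGroup (Fin 3) ℂ) (z : ℂ) (φ ψ : boxSpace L v)
    (ω : Site → ℝ) : ℝ := ‖inner ℂ φ (boxResolvent L v C ω z ψ)‖

theorem continuous_greenAbs (C : Matrix.unitaryGroup (Fin 3) ℂ) (hz : ‖z‖ ≠ 1)
    (φ ψ : boxSpace L v) : Continuous (greenAbs C z φ ψ) := by
  have hR : Continuous fun ω => boxResolvent L v C ω z := by
    refine continuous_iff_continuousAt.2 fun ω => ?_
    have h := continuousAt_inverse (isUnit_boxWalk_sub (L := L) (v := v) C ω hz)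
    exact ContinuousAt.comp (f := fun ω => boxWalk L v C ω -
      z • ContinuousLinearMap.id ℂ (boxSpace L v)) h
      ((continuous_boxWalk C).sub continuous_const).continuousAt
  unfold greenAbs
  exact (continuous_const.inner (hR.clm_apply continuous_const)).norm

theorem dependsOnPhase_greenAbs (C : Matrix.unitaryGroup (Fin 3) ℂ) (φ ψ : boxSpace L v) :
    DependsOnPhase (greenAbs C z φ ψ) := fun ω ω' h => by
  rw [greenAbs, greenAbs, boxResolvent, boxResolvent, dependsOnPhase_boxWalk C ω ω' h]

/-- The fractional moments of the matrix elements of the resolvent are bounded uniformly in the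
size of the box, the coin matrix and the spectral parameter. -/
theorem lintegral_greenAbs_rpow_le (C : Matrix.unitaryGroup (Fin 3) ℂ) (hz : ‖z‖ ≠ 1)
    {x y : Site} {i j : Fin 3} (hx : ket x i ∈ boxSpace L v) (hy : ket y j ∈ boxSpace L v)
    {s : ℝ} (hs0 : 0 < s) (hs1 : s < 1) :
    ∫⁻ ω, ENNReal.ofReal (greenAbs C z ⟨ket x i, hx⟩ ⟨ket y j, hy⟩ ω ^ s) ∂disorder ≤
      ENNReal.ofReal (momentBound s) := by
  -- A common phase at `x` and `y` places both vectors in the range of one projection, which also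
  -- covers `x = y`.
  have hx' : boxProj L v {x, y} ⟨ket x i, hx⟩ = ⟨ket x i, hx⟩ :=
    Subtype.ext (siteProj_ket_of_mem (Set.mem_insert _ _) i)
  have hy' : boxProj L v {x, y} ⟨ket y j, hy⟩ = ⟨ket y j, hy⟩ :=
    Subtype.ext (siteProj_ket_of_mem (Set.mem_insert_of_mem _ (Set.mem_singleton _)) j)
  have hdep : DependsOnPhase fun ω =>
      ENNReal.ofReal (greenAbs C z ⟨ket x i, hx⟩ ⟨ket y j, hy⟩ ω ^ s) := fun ω ω' h => by
    have h1 := dependsOnPhase_greenAbs (z := z) C ⟨ket x i, hx⟩ ⟨ket y j, hy⟩ ω ω' h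
    simp only [h1]
  refine lintegral_disorder_le (Measurable.ennreal_ofReal
    ((continuous_greenAbs C hz _ _).rpow_const fun _ => Or.inr hs0.le).measurable)
    hdep {x, y} fun ω => ?_
  simp only [greenAbs, boxResolvent, boxWalk_add_indicator]
  exact lintegral_inner_resolvent_le (isSymmetric_boxProj {x, y}) (boxProj_mul_self {x, y})
    (norm_boxWalk_apply C ω) hz hx' hy' (norm_ket x i).le (norm_ket y j).le hs0 hs1

/-! ### Resonances are rare -/

theorem exp_cellAngle (ω : Site → ℝ) (n : ℤ × ℤ) :
    Complex.exp (Complex.I * cellAngle ω n) = Complex.exp (Complex.I * ω (n, .A)) ^ 3 *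
      ∏ k, Complex.exp (Complex.I * ω (n - stepB k, .B)) := by
  rw [cellAngle, ← Complex.exp_nat_mul, ← Complex.exp_sum, ← Complex.exp_add]
  congr 1
  push_cast
  rw [mul_add, Finset.mul_sum]
  ring

theorem continuous_cellAngle (n : ℤ × ℤ) : Continuous fun ω => cellAngle ω n := by
  unfold cellAngle
  fun_prop

/-- Among the `B` sites of the cell only the one with index `1` has zero displacement, so the phase
at `(n, B)` enters exactly once and with coefficient one. -/
theorem cellAngle_add_indicator (ω : Site → ℝ) (n : ℤ × ℤ) (t : ℝ) :
    cellAngle (ω + Set.indicator {(n, Sublattice.B)} fun _ => t) n = cellAngle ω n + t := by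
  have h0 : stepB 0 ≠ 0 := by simp [stepB]
  have h2 : stepB 2 ≠ 0 := by simp [stepB]
  have h1 : stepB 1 = 0 := by simp [stepB]
  simp [cellAngle, Fin.sum_univ_three, h0, h1, h2]
  ring

theorem disorder_resonance_le (n : ℤ × ℤ) (w : ℂ) (κ : ℝ) :
    disorder {ω | ‖Complex.exp (Complex.I * cellAngle ω n) - w‖ < κ} ≤ ENNReal.ofReal κ := by
  set A : Set (Site → ℝ) := {ω | ‖Complex.exp (Complex.I * cellAngle ω n) - w‖ < κ} with hA
  have hAm : MeasurableSet A := by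
    have := continuous_cellAngle n
    exact (isOpen_lt (by fun_prop) continuous_const).measurableSet
  rw [← lintegral_indicator_one hAm]
  refine lintegral_disorder_le (measurable_one.indicator hAm) (fun ω ω' h => ?_)
    {(n, Sublattice.B)} fun ω => ?_
  · have : ω ∈ A ↔ ω' ∈ A := by
      simp only [hA, Set.mem_ofPred_eq, exp_cellAngle, h]
    simp [Set.indicator_apply, this]
  -- Rotating the target by the unshifted angle reduces the event to `e^{it}` lying near a fixed
  -- point.
  · set w' := w * Complex.exp (-(Complex.I * cellAngle ω n))
    have hiff : ∀ t : ℝ, (ω + Set.indicator {(n, Sublattice.B)} fun _ => t) ∈ A ↔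
        t ∈ {t : ℝ | ‖Complex.exp (Complex.I * t) - w'‖ < κ} := fun t => by
      simp only [hA, Set.mem_ofPred_eq, cellAngle_add_indicator]
      have : Complex.exp (Complex.I * ((cellAngle ω n + t : ℝ) : ℂ)) - w =
          Complex.exp (Complex.I * cellAngle ω n) * (Complex.exp (Complex.I * t) - w') := by
        push_cast
        rw [mul_sub, mul_add, Complex.exp_add, mul_left_comm _ w, Complex.exp_neg,
          mul_inv_cancel₀ (Complex.exp_ne_zero _), mul_one]
      rw [this, norm_mul, Complex.norm_exp_I_mul_ofReal, one_mul]
    have hm : MeasurableSet {t : ℝ | ‖Complex.exp (Complex.I * t) - w'‖ < κ} :=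
      (isOpen_lt (by fun_prop) continuous_const).measurableSet
    calc _ = ∫⁻ t, Set.indicator {t : ℝ | ‖Complex.exp (Complex.I * t) - w'‖ < κ} 1 t
          ∂uniformPhase := by
          refine lintegral_congr fun t => ?_
          by_cases ht : t ∈ {t : ℝ | ‖Complex.exp (Complex.I * t) - w'‖ < κ}
          · rw [Set.indicator_of_mem ht, Set.indicator_of_mem ((hiff t).2 ht)]
            rfl
          · rw [Set.indicator_of_notMem ht, Set.indicator_of_notMem (mt (hiff t).1 ht)]
      _ ≤ _ := by
          rw [lintegral_indicator_one hm]
          exact uniformPhase_norm_sub_lt_le w' κ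

/-- The phase configurations for which the walk with coin `C₀` on the box has a spectral value
close to `z`. -/
def resonant (L : ℕ × ℕ) (v : ℤ × ℤ) (z : ℂ) (η : ℝ) : Set (Site → ℝ) :=
  {ω | ∃ n, n - v ∈ boxCells L ∧
    ‖Complex.exp (Complex.I * cellAngle ω n) - z ^ 6‖ < 6 * max 1 ‖z‖ ^ 5 * η}

theorem measurableSet_resonant (L : ℕ × ℕ) (v : ℤ × ℤ) (z : ℂ) (η : ℝ) :
    MeasurableSet (resonant L v z η) := by
  have h : resonant L v z η = ⋃ n : ℤ × ℤ, {ω | n - v ∈ boxCells L ∧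
      ‖Complex.exp (Complex.I * cellAngle ω n) - z ^ 6‖ < 6 * max 1 ‖z‖ ^ 5 * η} := by
    ext ω
    simp [resonant]
  rw [h]
  refine MeasurableSet.iUnion fun n => MeasurableSet.const _ |>.inter ?_
  have := continuous_cellAngle n
  exact (isOpen_lt (f := fun ω => ‖Complex.exp (Complex.I * cellAngle ω n) - z ^ 6‖)
    (by fun_prop) continuous_const).measurableSet

/-- A union bound over at most `4 L₁ L₂ ≤ 2|L|²` cells. For `|z| < 2` each event has probability at
most `6 · 2⁵ η = 192η`, whence `384`. -/
theorem disorder_resonant_le {L : ℕ × ℕ} (v : ℤ × ℤ) (z : ℂ) {η : ℝ} (hη : 0 ≤ η)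
    (hη' : η ≤ 1 / 18) :
    disorder (resonant L v z η) ≤ ENNReal.ofReal (384 * (boxSize L ^ 2 * η)) := by
  rcases le_or_gt 2 ‖z‖ with hz | hz
  -- For `|z| ≥ 2` the distance from `z⁶` to the circle is at least `|z|⁶ - 1 ≥ |z|⁵`, beyond the
  -- threshold `6|z|⁵η ≤ |z|⁵/3`.
  · have hempty : resonant L v z η = ∅ := by
      refine Set.eq_empty_of_forall_notMem ?_
      rintro ω ⟨n, -, hn⟩
      rw [max_eq_right (by linarith)] at hn
      have h1 := norm_sub_norm_le (z ^ 6) (Complex.exp (Complex.I * cellAngle ω n))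
      rw [norm_sub_rev, Complex.norm_exp_I_mul_ofReal, norm_pow] at h1
      have h2 : 1 ≤ ‖z‖ ^ 5 := one_le_pow₀ (by linarith)
      nlinarith [mul_le_mul_of_nonneg_left hη' (by positivity : 0 ≤ 6 * ‖z‖ ^ 5),
        mul_le_mul_of_nonneg_left hz (by positivity : 0 ≤ ‖z‖ ^ 5)]
    rw [hempty, measure_empty]
    exact zero_le
  · set κ := 6 * max 1 ‖z‖ ^ 5 * η with hκ
    have hκ' : κ ≤ 192 * η := by
      have : max 1 ‖z‖ ^ 5 ≤ 2 ^ 5 :=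
        pow_le_pow_left₀ (by positivity) (max_le (by norm_num) hz.le) 5
      rw [hκ]
      gcongr
      linarith
    set T : Finset (ℤ × ℤ) := Finset.Icc (-(L.1 : ℤ)) (L.1 - 1) ×ˢ
      Finset.Icc (-(L.2 : ℤ)) (L.2 - 1) with hT
    have hcard : (T.card : ℝ) = 4 * L.1 * L.2 := by
      rw [hT, Finset.card_product, Int.card_Icc, Int.card_Icc,
        show ((L.1 : ℤ) - 1 + 1 - -L.1).toNat = 2 * L.1 by omega,
        show ((L.2 : ℤ) - 1 + 1 - -L.2).toNat = 2 * L.2 by omega]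
      push_cast
      ring
    have hsub : resonant L v z η ⊆
        ⋃ m ∈ T, {ω | ‖Complex.exp (Complex.I * cellAngle ω (m + v)) - z ^ 6‖ < κ} := by
      rintro ω ⟨n, hn, hω⟩
      refine Set.mem_biUnion (x := n - v) ?_ ?_
      · rw [hT, SetLike.mem_coe, Finset.mem_product, Finset.mem_Icc, Finset.mem_Icc]
        exact ⟨⟨hn.1, hn.2.1⟩, hn.2.2.1, hn.2.2.2.1⟩
      · rw [sub_add_cancel]
        exact hω
    calc disorder (resonant L v z η)
        ≤ ∑ m ∈ T, disorder
          {ω | ‖Complex.exp (Complex.I * cellAngle ω (m + v)) - z ^ 6‖ < κ} :=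
          (measure_mono hsub).trans (measure_biUnion_finset_le T _)
      _ ≤ ∑ _m ∈ T, ENNReal.ofReal κ :=
          Finset.sum_le_sum fun m _ => disorder_resonance_le (m + v) (z ^ 6) κ
      _ = ENNReal.ofReal (T.card * κ) := by
          rw [Finset.sum_const, nsmul_eq_mul, ENNReal.ofReal_mul (Nat.cast_nonneg _),
            ENNReal.ofReal_natCast]
      _ ≤ _ := by
          refine ENNReal.ofReal_le_ofReal ?_
          have hsq : boxSize L ^ 2 = (L.1 : ℝ) ^ 2 + (L.2 : ℝ) ^ 2 := Real.sq_sqrt (by positivity)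
          rw [hcard, hsq]
          have h1 : 4 * (L.1 : ℝ) * L.2 ≤ 2 * ((L.1 : ℝ) ^ 2 + (L.2 : ℝ) ^ 2) := by
            nlinarith [sq_nonneg ((L.1 : ℝ) - L.2)]
          calc 4 * (L.1 : ℝ) * L.2 * κ ≤ 4 * (L.1 : ℝ) * L.2 * (192 * η) := by gcongr
            _ ≤ 2 * ((L.1 : ℝ) ^ 2 + (L.2 : ℝ) ^ 2) * (192 * η) := by gcongr
            _ = _ := by ring

/-! ### Off-diagonal matrix elements -/

theorem norm_sub_le_entrySup (M N : Matrix (Fin 3) (Fin 3) ℂ) (k l : Fin 3) :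
    ‖M k l - N k l‖ ≤ entrySup (M - N) :=
  Finset.le_sup' (fun q : Fin 3 × Fin 3 => ‖(M - N) q.1 q.2‖) (Finset.mem_univ (k, l))

/-- The resolvent equation is read on the whole lattice, where the boxed coins differ from `C₀` by
at most `δ` at every site and not at all on the rim. Only cells of the box matter, because the
solution is supported there. -/
theorem greenAbs_le_of_notMem_resonant {C : Matrix.unitaryGroup (Fin 3) ℂ} (hz : ‖z‖ ≠ 1)
    {η δ : ℝ} (hη : 0 < η) (hδ : 0 ≤ δ) (hδη : 6 * δ ≤ η)
    (hC : entrySup ((C : Matrix (Fin 3) (Fin 3) ℂ) - coinZero) ≤ δ)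
    {x y : Site} {i j : Fin 3} (hx : ket x i ∈ boxSpace L v) (hy : ket y j ∈ boxSpace L v)
    (hxy : ¬ Equivalent x i y j) {ω : Site → ℝ} (hω : ω ∉ resonant L v z η) :
    greenAbs C z ⟨ket x i, hx⟩ ⟨ket y j, hy⟩ ω ≤ 6 * δ / η ^ 2 := by
  classical
  set ψ : boxSpace L v := boxResolvent L v C ω z ⟨ket y j, hy⟩ with hψ
  have h1 : greenAbs C z ⟨ket x i, hx⟩ ⟨ket y j, hy⟩ ω = ‖(ψ : WalkSpace) x i‖ := by
    have h2 : inner ℂ (⟨ket x i, hx⟩ : boxSpace L v) ψ = inner ℂ (ket x i) (ψ : WalkSpace) := rfl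
    rw [greenAbs, ← hψ, h2, ket, lp.inner_single_left, EuclideanSpace.inner_single_left]
    simp
  rw [h1]
  refine norm_resolvent_coord_le (B := {n | n - v ∈ boxCells L}) (z := z) (ω := ω) hη
    (fun n hn => ?_) (C := boxCoin L v C) hδ hδη (fun u k l => ?_)
    (cellLabel_mem_of_ket_mem_boxSpace hx) (cellLabel_ne_of_not_equivalent hxy)
    (boxSpace_le_supportedIn L v ψ.2) ?_
  · by_contra! h
    exact hω ⟨n, hn, h⟩
  · obtain ⟨m, _ | _⟩ := u
    · exact (norm_sub_le_entrySup _ _ k l).trans hC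
    · rw [boxCoin]
      split_ifs
      · simpa using hδ
      · exact (norm_sub_le_entrySup _ _ k l).trans hC
  · exact congrArg Subtype.val
      (apply_inverse_apply (isUnit_boxWalk_sub C ω hz) (⟨ket y j, hy⟩ : boxSpace L v))

/-- Splitting an expectation into a part on which the integrand is small and a rare event, on
which a higher moment is used. -/
theorem lintegral_ofReal_rpow_le {Ω : Type*} [MeasurableSpace Ω] {μ : Measure Ω}
    [IsProbabilityMeasure μ] {f : Ω → ℝ} (hf : Measurable f) (hf0 : ∀ ω, 0 ≤ f ω) {N : Set Ω}
    (hN : MeasurableSet N) {s p q : ℝ} (hs : 0 ≤ s) (hpq : q.HolderConjugate p) {b M ε : ℝ}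
    (hM : 0 ≤ M) (hb0 : 0 ≤ b) (hb : ∀ ω ∉ N, f ω ≤ b)
    (hMom : ∫⁻ ω, ENNReal.ofReal (f ω ^ (s * q)) ∂μ ≤ ENNReal.ofReal M)
    (hε0 : 0 ≤ ε) (hε : μ N ≤ ENNReal.ofReal ε) :
    ∫⁻ ω, ENNReal.ofReal (f ω ^ s) ∂μ ≤
      ENNReal.ofReal (M ^ (1 / q) * ε ^ (1 / p) + b ^ s) := by
  have hq := hpq.pos
  have hp := hpq.symm.pos
  have hFm : Measurable fun ω => ENNReal.ofReal (f ω ^ s) := (hf.pow_const s).ennreal_ofReal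
  have hrare : ∫⁻ ω in N, ENNReal.ofReal (f ω ^ s) ∂μ ≤
      ENNReal.ofReal (M ^ (1 / q) * ε ^ (1 / p)) := by
    have h1 := ENNReal.lintegral_mul_le_Lp_mul_Lq μ hpq hFm.aemeasurable
      (measurable_one.indicator hN : Measurable (N.indicator (1 : Ω → ENNReal))).aemeasurable
    have h2 : ∀ ω, ENNReal.ofReal (f ω ^ s) ^ q = ENNReal.ofReal (f ω ^ (s * q)) := fun ω => by
      rw [ENNReal.ofReal_rpow_of_nonneg (Real.rpow_nonneg (hf0 ω) s) hq.le,
        ← Real.rpow_mul (hf0 ω)]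
    have h3 : ∀ ω, N.indicator (1 : Ω → ENNReal) ω ^ p = N.indicator (1 : Ω → ENNReal) ω :=
      fun ω => by
        by_cases hω : ω ∈ N
        · simp [hω]
        · simp [hω, hp]
    have h4 : ∫⁻ ω, ((fun ω => ENNReal.ofReal (f ω ^ s)) * N.indicator (1 : Ω → ENNReal)) ω ∂μ =
        ∫⁻ ω in N, ENNReal.ofReal (f ω ^ s) ∂μ := by
      rw [← lintegral_indicator hN]
      refine lintegral_congr fun ω => ?_
      by_cases hω : ω ∈ N <;> simp [hω]
    simp only [h2, h3, lintegral_indicator_one hN] at h1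
    rw [h4] at h1
    refine h1.trans ?_
    rw [ENNReal.ofReal_mul (by positivity), ← ENNReal.ofReal_rpow_of_nonneg hM (by positivity),
      ← ENNReal.ofReal_rpow_of_nonneg hε0 (by positivity)]
    gcongr
  have htyp : ∫⁻ ω in Nᶜ, ENNReal.ofReal (f ω ^ s) ∂μ ≤ ENNReal.ofReal (b ^ s) := by
    calc _ ≤ ∫⁻ _ in Nᶜ, ENNReal.ofReal (b ^ s) ∂μ :=
          setLIntegral_mono measurable_const fun ω hω =>
            ENNReal.ofReal_le_ofReal (Real.rpow_le_rpow (hf0 ω) (hb ω hω) hs)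
      _ ≤ _ := by
          rw [setLIntegral_const]
          exact mul_le_of_le_one_right' prob_le_one
  rw [← lintegral_add_compl _ hN, ENNReal.ofReal_add (by positivity) (by positivity)]
  exact add_le_add hrare htyp

theorem momentBound_pos {s : ℝ} (hs0 : 0 < s) (hs1 : s < 1) : 0 < momentBound s := by
  have hcos : 0 < Real.cos (Real.pi / 2 * s) :=
    Real.cos_pos_of_mem_Ioo ⟨by nlinarith [Real.pi_pos], by nlinarith [Real.pi_pos]⟩
  rw [momentBound]
  positivity

theorem eighteen_le_boxSize_sq (hL : 3 ≤ min L.1 L.2) : 18 ≤ boxSize L ^ 2 := by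
  have h1 : (3 : ℝ) ≤ L.1 := by exact_mod_cast (le_min_iff.1 hL).1
  have h2 : (3 : ℝ) ≤ L.2 := by exact_mod_cast (le_min_iff.1 hL).2
  rw [boxSize, Real.sq_sqrt (by positivity)]
  nlinarith

theorem lintegral_greenAbs_rpow_le_of_not_equivalent {s p a : ℝ} (hs0 : 0 < s) (hs1 : s < 1)
    (hp : 1 / (1 - s) < p) (ha : 0 ≤ a) (hL : 3 ≤ min L.1 L.2) (hz : ‖z‖ ≠ 1)
    {C : Matrix.unitaryGroup (Fin 3) ℂ}
    (hC : entrySup ((C : Matrix (Fin 3) (Fin 3) ℂ) - coinZero) ≤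
      1 / boxSize L ^ (2 * a * p + 4 + a / s))
    {x y : Site} {i j : Fin 3} (hx : ket x i ∈ boxSpace L v) (hy : ket y j ∈ boxSpace L v)
    (hxy : ¬ Equivalent x i y j) :
    ∫⁻ ω, ENNReal.ofReal (greenAbs C z ⟨ket x i, hx⟩ ⟨ket y j, hy⟩ ω ^ s) ∂disorder ≤
      ENNReal.ofReal ((momentBound (s * (p / (p - 1))) ^ (1 - 1 / p) * 384 ^ (1 / p) + 6 ^ s) /
        boxSize L ^ a) := by
  have hs1' : 0 < 1 - s := sub_pos.2 hs1
  have hp1 : 1 < p := by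
    refine lt_trans ?_ hp
    rw [lt_div_iff₀ hs1']
    linarith
  have hp0 : 0 < p := zero_lt_one.trans hp1
  have hpm : 0 < p - 1 := sub_pos.2 hp1
  set q := p / (p - 1) with hq
  have hq0 : 0 < q := by positivity
  have hpq : q.HolderConjugate p := (Real.HolderConjugate.conjExponent hp1).symm
  have h1q : 1 / q = 1 - 1 / p := by
    rw [hq]
    field_simp
  -- The hypothesis on `p` is used here: the Hölder exponent must leave a moment of order below one.
  have hsq1 : s * q < 1 := by
    rw [div_lt_iff₀ hs1'] at hp
    rw [hq, ← mul_div_assoc, div_lt_one hpm]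
    linarith
  have hR2 := eighteen_le_boxSize_sq hL
  set R := boxSize L
  have hR0 : 0 ≤ R := Real.sqrt_nonneg _
  -- Boxes with both sides at least `3` have `R² ≥ 18`; this yields the two smallness conditions `η
  -- ≤ 1/18` and `6δ ≤ η` below.
  have hR1 : 1 ≤ R := by nlinarith
  have hRpos : 0 < R := zero_lt_one.trans_le hR1
  -- The exponent makes the resonance probability `384 R² η = 384 R^{-ap}`, whose power `1/p` decays
  -- like `R^{-a}`. The given closeness of the coins is `δ = η² R^{-a/s}`, so off resonance
  -- `(6δ/η²)ˢ = 6ˢ R^{-a}`.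
  set η := R ^ (-(a * p + 2)) with hη
  set δ := 1 / R ^ (2 * a * p + 4 + a / s) with hδ
  have hδ' : δ = R ^ (-(2 * a * p + 4 + a / s)) := by
    rw [hδ, Real.rpow_neg hR0, one_div]
  have hη0 : 0 < η := Real.rpow_pos_of_pos hRpos _
  have hδ0 : 0 ≤ δ := by positivity
  have hR2' : R ^ (-2 : ℝ) ≤ 1 / 18 := by
    rw [Real.rpow_neg hR0, Real.rpow_two, ← one_div]
    exact one_div_le_one_div_of_le (by norm_num) hR2
  have hap : 0 ≤ a * p := by positivity
  have has : 0 ≤ a / s := by positivity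
  have hη18 : η ≤ 1 / 18 :=
    (Real.rpow_le_rpow_of_exponent_le hR1 (by linarith)).trans hR2'
  have hδη : 6 * δ ≤ η := by
    have h1 : δ = η * R ^ (-(a * p + 2 + a / s)) := by
      rw [hδ', hη, ← Real.rpow_add hRpos]
      congr 1
      ring
    have h2 : R ^ (-(a * p + 2 + a / s)) ≤ 1 / 18 :=
      (Real.rpow_le_rpow_of_exponent_le hR1 (by linarith)).trans hR2'
    rw [h1]
    nlinarith
  have hb : 6 * δ / η ^ 2 = 6 * R ^ (-(a / s)) := by
    have : δ = R ^ (-(a / s)) * η ^ 2 := by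
      rw [hδ', hη, ← Real.rpow_natCast, ← Real.rpow_mul hR0, ← Real.rpow_add hRpos]
      congr 1
      push_cast
      ring
    rw [this]
    field_simp
  have hε : R ^ 2 * η = R ^ (-(a * p)) := by
    rw [hη, ← Real.rpow_two, ← Real.rpow_add hRpos]
    congr 1
    ring
  refine (lintegral_ofReal_rpow_le (continuous_greenAbs C hz _ _).measurable
    (fun ω => norm_nonneg _) (measurableSet_resonant L v z η) hs0.le hpq
    (momentBound_pos (by positivity) hsq1).le (by positivity)
    (fun ω hω => greenAbs_le_of_notMem_resonant hz hη0 hδ0 hδη hC hx hy hxy hω)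
    (lintegral_greenAbs_rpow_le C hz hx hy (by positivity) hsq1) (by positivity)
    (disorder_resonant_le v z hη0.le hη18)).trans (le_of_eq ?_)
  congr 1
  have h3 : (384 * R ^ (-(a * p))) ^ (1 / p) = 384 ^ (1 / p) * R ^ (-a) := by
    rw [Real.mul_rpow (by norm_num) (by positivity), ← Real.rpow_mul hR0]
    congr 2
    field_simp
  have h4 : (6 * R ^ (-(a / s))) ^ s = 6 ^ s * R ^ (-a) := by
    rw [Real.mul_rpow (by norm_num) (by positivity), ← Real.rpow_mul hR0]
    congr 2
    field_simp
  rw [hb, hε, h3, h4, h1q, Real.rpow_neg hR0]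
  field_simp

end HexWalk

/-! ### The proposition for Bochner expectations -/

theorem mainTheorem7 (s p a : ℝ) (hs0 : 0 < s) (hs1 : s < 1) (hp : 1 / (1 - s) < p)
    (ha : 0 ≤ a) :
    ∃ c : ℝ, 0 < c ∧
      ∀ (L : ℕ × ℕ), 3 ≤ min L.1 L.2 →
      ∀ (z : ℂ), ‖z‖ ≠ 1 →
      ∀ (C : Matrix.unitaryGroup (Fin 3) ℂ),
        HexWalk.entrySup ((C : Matrix (Fin 3) (Fin 3) ℂ) - HexWalk.coinZero) ≤
          1 / HexWalk.boxSize L ^ (2 * a * p + 4 + a / s) →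
      ∀ (v : ℤ × ℤ) (x : HexWalk.Site) (i : Fin 3) (y : HexWalk.Site) (j : Fin 3)
        (hx : HexWalk.ket x i ∈ HexWalk.boxSpace L v)
        (hy : HexWalk.ket y j ∈ HexWalk.boxSpace L v),
        ¬ HexWalk.Equivalent x i y j →
        (∀ ω : HexWalk.Site → ℝ, IsUnit
          (HexWalk.boxWalk L v C ω - z • ContinuousLinearMap.id ℂ (HexWalk.boxSpace L v))) ∧
        Integrable (fun ω : HexWalk.Site → ℝ =>
          ‖inner ℂ (⟨HexWalk.ket x i, hx⟩ : HexWalk.boxSpace L v)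
            (HexWalk.boxResolvent L v C ω z ⟨HexWalk.ket y j, hy⟩)‖ ^ s) HexWalk.disorder ∧
        ∫ ω : HexWalk.Site → ℝ,
          ‖inner ℂ (⟨HexWalk.ket x i, hx⟩ : HexWalk.boxSpace L v)
            (HexWalk.boxResolvent L v C ω z ⟨HexWalk.ket y j, hy⟩)‖ ^ s ∂HexWalk.disorder ≤
          c / HexWalk.boxSize L ^ a := by
  set c := HexWalk.momentBound (s * (p / (p - 1))) ^ (1 - 1 / p) * 384 ^ (1 / p) + 6 ^ s
  have hp1 : 1 < p := by
    refine lt_trans ?_ hp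
    rw [lt_div_iff₀ (sub_pos.2 hs1)]
    linarith
  have hsq1 : s * (p / (p - 1)) < 1 := by
    rw [div_lt_iff₀ (sub_pos.2 hs1)] at hp
    rw [← mul_div_assoc, div_lt_one (sub_pos.2 hp1)]
    linarith
  have hc : 0 < c := by
    have := HexWalk.momentBound_pos
      (mul_pos hs0 (div_pos (zero_lt_one.trans hp1) (sub_pos.2 hp1))) hsq1
    positivity
  refine ⟨c, hc, fun L hL z hz C hC v x i y j hx hy hxy =>
    ⟨fun ω => HexWalk.isUnit_boxWalk_sub C ω hz, ?_⟩⟩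
  have hcont := (HexWalk.continuous_greenAbs C hz (⟨HexWalk.ket x i, hx⟩ : HexWalk.boxSpace L v)
    ⟨HexWalk.ket y j, hy⟩).rpow_const (p := s) fun _ => Or.inr hs0.le
  have hle := HexWalk.lintegral_greenAbs_rpow_le_of_not_equivalent hs0 hs1 hp ha hL hz hC hx hy hxy
  have hnn : ∀ ω : HexWalk.Site → ℝ, 0 ≤ HexWalk.greenAbs C z
      (⟨HexWalk.ket x i, hx⟩ : HexWalk.boxSpace L v) ⟨HexWalk.ket y j, hy⟩ ω ^ s := fun ω =>
    Real.rpow_nonneg (norm_nonneg _) s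
  constructor
  · refine ⟨hcont.aestronglyMeasurable, ?_⟩
    exact (hasFiniteIntegral_iff_ofReal (ae_of_all _ hnn)).2 <| hle.trans_lt ENNReal.ofReal_lt_top
  · change ∫ ω, HexWalk.greenAbs C z _ _ ω ^ s ∂HexWalk.disorder ≤ _
    rw [integral_eq_lintegral_of_nonneg_ae (ae_of_all _ hnn) hcont.aestronglyMeasurable]
    refine ENNReal.toReal_le_of_le_ofReal ?_ hle
    exact div_nonneg hc.le (Real.rpow_nonneg (Real.sqrt_nonneg _) a)
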